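/- Let $\ell$ be a prime, let $\overline{\mathbb Q}\subset\mathbb C$ be the algebraic closure of $\mathbb Q$, $G_{\mathbb Q}=\mathrm{Gal}(\overline{\mathbb Q}/\mathbb Q)$, $\zeta_N=e^{2\pi i/N}$, and let $\chi:G_{\mathbb Q}\to\mathbb Z_\ell^\times$ be the $\ell$-adic cyclotomic character. Let $K\subset\mathbb C$ be a field with algebraic closure $\overline K\subset\mathbb C$ and let $\gamma$ be a path on $\mathbf P^1(\mathbb C)\setminus\{0,1,\infty\}$ from the tangential base point $\overrightarrow{01}$ to a point $z\in K$. Along $\gamma$, let $z^{1/N}$ denote the value at the end of $\gamma$ of the continuous branch of the $N$-th root of the coordinate which is asymptotically positive real at the start, and let $(1-\zeta_N^{\alpha}z^{1/N})^{1/N}$ $(\alpha\in\mathbb Z/N)$ denote the value at the end of $\gamma$ of the continuous branch which equals $1$ at the start. For $\sigma\in G_K=\mathrm{Gal}(\overline K/K)$ (with $\chi$ now the cyclotomic character of $G_K$) let $\rho_z(\sigma)\in\mathbb Z_\ell$ be given by $\sigma(z^{1/\ell^n})=\zeta_{\ell^n}^{\rho_z(\sigma)}z^{1/\ell^n}$ for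 all $n$. For $m\ge1$ the $\ell$-adic polylogarithmic character $\tilde\chi_m^{z}=\tilde\chi_m^{z,\gamma}:G_K\to\mathbb Z_\ell$ is defined by the Kummer properties $$\zeta_{\ell^n}^{\tilde\chi_m^z(\sigma)}=\sigma\Bigl(\prod_{a=0}^{\ell^n-1}(1-\zeta_{\ell^n}^{\chi(\sigma)^{-1}a}z^{1/\ell^n})^{\frac{a^{m-1}}{\ell^n}}\Bigr)\Bigm/\prod_{a=0}^{\ell^n-1}(1-\zeta_{\ell^n}^{a+\rho_z(\sigma)}z^{1/\ell^n})^{\frac{a^{m-1}}{\ell^n}}\qquad(n\ge 0,\ 0^0=1).$$ Let $\rho_2:G_{\mathbb Q}\to\mathbb Z_\ell$ be the Kummer $1$-cocycle for the positive real roots of $2$: $\sigma(2^{1/\ell^n})=\zeta_{\ell^n}^{\rho_2(\sigma)}2^{1/\ell^n}$ for all $n$. Let $\gamma_{-1}:\overrightarrow{01}\rightsquigarrow -1$ be the path which follows the real axis from $0$ towards $1$, passes above $1$ through the upper half plane, and follows the positive half arc of the unit circle to $-1$; or, more generally, let it be any path from $\overrightarrow{01}$ to $-1$ on $\mathbf P^1(\mathbb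 C)\setminus\{0,1,\infty\}$ inside the closed upper half plane (all such paths are homotopic). Then, along $\gamma_{-1}$, for every $\sigma\in G_{\mathbb Q}$ there is an element $\tilde\chi_2^{z=-1}(\sigma)\in\mathbb Z_\ell$ with the Kummer properties for $m=2$, $z=-1$, and $$\tilde\chi_2^{z=-1}(\sigma)=-\frac{\chi(\sigma)^2-1}{48}-\frac12\,\chi(\sigma)\,\rho_2(\sigma).$$ -/

import Mathlib

open scoped Topology

noncomputable section

/-! ### Continuous branches of roots along a path -/

/-- A nowhere vanishing continuous function on `[0,1]` with value `1` at `0` has exactly one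
continuous `N`-th root with value `1` at `0`. -/
theorem existsUnique_root (N : ℕ) [NeZero N] (f : C(unitInterval, ℂ)) (hf : ∀ t, f t ≠ 0) (h0 : f 0 = 1) :
    ∃! u : C(unitInterval, ℂ), u 0 = 1 ∧ ∀ t, u t ^ N = f t := by
  have cov := isCoveringMap_npow (𝕜 := ℂ) N (by exact_mod_cast NeZero.ne N)
  let F : C(unitInterval, {x : ℂ // x ≠ 0}) := ⟨fun t => ⟨f t, hf t⟩, by fun_prop⟩
  obtain ⟨Γ, h1, h2⟩ := cov.exists_path_lifts F ⟨1, one_ne_zero⟩ (by ext; simp [F, h0])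
  refine ⟨⟨fun t => (Γ t).1, by fun_prop⟩, ⟨by simp [h2], fun t => ?_⟩, ?_⟩
  · have := congrArg Subtype.val (congrFun h1 t)
    exact this
  · rintro u ⟨hu0, hu⟩
    have hne : ∀ t, u t ≠ 0 := fun t h => hf t (by rw [← hu t, h, zero_pow (NeZero.ne N)])
    let G : unitInterval → {x : ℂ // x ≠ 0} := fun t => ⟨u t, hne t⟩
    have hG : Continuous G := by fun_prop
    have key := cov.eq_of_comp_eq hG Γ.continuous
      (by rw [h1]; funext t; ext; simpa [G, F] using hu t) 0 (by ext; simp [G, h2, hu0])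
    ext t
    simpa [G] using congrArg Subtype.val (congrFun key t)

/-- A path on `ℙ¹ ∖ {0, 1, ∞}` from the tangential base point at `0` given by the unit vector
towards `1`, to the point `z`: it leaves `0` in the direction of the positive real axis. -/
structure TangentialPath (z : ℂ) where
  toMap : C(unitInterval, ℂ)
  source : toMap 0 = 0
  target : toMap 1 = z
  ne_zero : ∀ t, t ≠ 0 → toMap t ≠ 0
  ne_one : ∀ t, toMap t ≠ 1
  tangent : Filter.Tendsto (fun t => toMap t / (‖toMap t‖ : ℂ)) (𝓝[≠] 0) (𝓝 1)

namespace TangentialPath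

variable {z : ℂ} (γ : TangentialPath z)

/-- The direction of a path issued from the tangential base point, with value `1` at the start. -/
def direction : C(unitInterval, ℂ) where
  toFun := Function.update (fun t => γ.toMap t / (‖γ.toMap t‖ : ℂ)) 0 1
  continuous_toFun := by
    rw [continuous_iff_continuousAt]
    intro t
    by_cases ht : t = 0
    · subst ht
      exact continuousAt_update_same.2 γ.tangent
    · rw [continuousAt_update_of_ne ht]
      refine ContinuousAt.div (by fun_prop) (by fun_prop) ?_
      simpa using γ.ne_zero t ht

/-- `r` is the continuous branch of the `N`-th root `z ^ (1 / N)` along the path that is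
tangent to the positive real axis at the start (i.e. continues the positive root of the
coordinate near the base point). -/
def IsRootBranch (N : ℕ) (r : C(unitInterval, ℂ)) : Prop :=
  (∀ t, r t ^ N = γ.toMap t) ∧
    Filter.Tendsto (fun t => r t / (‖r t‖ : ℂ)) (𝓝[≠] 0) (𝓝 1)

theorem existsUnique_isRootBranch (N : ℕ) [NeZero N] : ∃! r : C(unitInterval, ℂ), γ.IsRootBranch N r := by
  have hN := NeZero.ne N
  have hdir : ∀ t, t ≠ 0 → γ.direction t = γ.toMap t / (‖γ.toMap t‖ : ℂ) := fun t ht => by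
    simp [direction, Function.update_of_ne ht]
  have hdir0 : γ.direction 0 = 1 := by simp [direction]
  have hnorm : ∀ t, ‖γ.direction t‖ = 1 := fun t => by
    by_cases ht : t = 0
    · subst ht; simp [hdir0]
    · rw [hdir t ht]; simp [γ.ne_zero t ht]
  obtain ⟨v, ⟨hv0, hv⟩, huniq⟩ := existsUnique_root N γ.direction
    (fun t h => by simpa [h] using hnorm t) hdir0
  have hvn : ∀ t, ‖v t‖ = 1 := fun t => by
    have h : ‖v t‖ ^ N = 1 := by rw [← norm_pow, hv, hnorm]
    exact (pow_eq_one_iff_of_nonneg (norm_nonneg _) hN).1 h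
  let s : unitInterval → ℝ := fun t => ‖γ.toMap t‖ ^ ((N : ℝ)⁻¹)
  have hs : Continuous s := by
    refine Continuous.rpow_const (by fun_prop) (fun t => Or.inr (by positivity))
  have hsN : ∀ t, s t ^ N = ‖γ.toMap t‖ := fun t =>
    Real.rpow_inv_natCast_pow (norm_nonneg _) hN
  have hs0 : ∀ t, 0 ≤ s t := fun t => by positivity
  have hspos : ∀ t, t ≠ 0 → 0 < s t := fun t ht =>
    Real.rpow_pos_of_pos (norm_pos_iff.2 (γ.ne_zero t ht)) _
  refine ⟨⟨fun t => (s t : ℂ) * v t, by fun_prop⟩, ⟨fun t => ?_, ?_⟩, ?_⟩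
  · change ((s t : ℂ) * v t) ^ N = _
    rw [mul_pow, hv, ← Complex.ofReal_pow, hsN]
    by_cases ht : t = 0
    · subst ht; simp [γ.source]
    · rw [hdir t ht]
      have : (‖γ.toMap t‖ : ℂ) ≠ 0 := by simpa using γ.ne_zero t ht
      field_simp
  · have hlim : Filter.Tendsto v (𝓝[≠] 0) (𝓝 1) := by
      rw [← hv0]; exact v.continuous.continuousAt.tendsto.mono_left nhdsWithin_le_nhds
    refine hlim.congr' ?_
    filter_upwards [self_mem_nhdsWithin] with t ht
    have h1 := hspos t ht
    have h2 : (s t : ℂ) ≠ 0 := by exact_mod_cast h1.ne'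
    change v t = (s t : ℂ) * v t / (‖(s t : ℂ) * v t‖ : ℂ)
    rw [norm_mul, hvn, Complex.norm_real, Real.norm_of_nonneg h1.le, mul_one]
    field_simp
  · rintro r ⟨hr, hrt⟩
    have hrn : ∀ t, ‖r t‖ = s t := fun t => by
      have h : ‖r t‖ ^ N = s t ^ N := by rw [← norm_pow, hr, hsN]
      exact (pow_left_inj₀ (norm_nonneg _) (hs0 t) hN).1 h
    let w : C(unitInterval, ℂ) := ⟨Function.update (fun t => r t / (‖r t‖ : ℂ)) 0 1, by
      rw [continuous_iff_continuousAt]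
      intro t
      by_cases ht : t = 0
      · subst ht
        exact continuousAt_update_same.2 hrt
      · rw [continuousAt_update_of_ne ht]
        refine ContinuousAt.div (by fun_prop) (by fun_prop) ?_
        rw [hrn]; exact_mod_cast (hspos t ht).ne'⟩
    have hw : ∀ t, t ≠ 0 → w t = r t / (‖r t‖ : ℂ) := fun t ht => by
      simp [w, Function.update_of_ne ht]
    have hwv : w = v := huniq w ⟨by simp [w], fun t => by
      by_cases ht : t = 0
      · subst ht; simp [w, hdir0]
      · rw [hw t ht, hdir t ht, div_pow, hr, hrn, ← Complex.ofReal_pow, hsN]⟩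
    ext t
    change r t = (s t : ℂ) * v t
    by_cases ht : t = 0
    · subst ht
      have : ‖r 0‖ = 0 := by
        rw [hrn]; simp [s, γ.source, hN]
      rw [norm_eq_zero.1 this]
      simp [s, γ.source, hN]
    · rw [← hwv, hw t ht, hrn]
      have : (s t : ℂ) ≠ 0 := by exact_mod_cast (hspos t ht).ne'
      field_simp

/-- The branch of `z ^ (1 / N)` along the path. -/
def rootBranch (N : ℕ) [NeZero N] : C(unitInterval, ℂ) := (γ.existsUnique_isRootBranch N).choose

theorem rootBranch_spec (N : ℕ) [NeZero N] : γ.IsRootBranch N (γ.rootBranch N) :=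
  (γ.existsUnique_isRootBranch N).choose_spec.1

end TangentialPath

/-- The root of unity `ζ_N = exp (2 π i / N)`. -/
def zetaC (N : ℕ) : ℂ := Complex.exp (2 * Real.pi * Complex.I / N)

theorem zetaC_pow (N : ℕ) [NeZero N] : zetaC N ^ N = 1 :=
  (Complex.isPrimitiveRoot_exp N (NeZero.ne N)).pow_eq_one

namespace TangentialPath

variable {z : ℂ} (γ : TangentialPath z)

/-- The function `1 - ζ_N ^ α * z ^ (1 / N)` along the path, for `α` modulo `N`. -/
def oneSub (N : ℕ) [NeZero N] (α : ZMod N) : C(unitInterval, ℂ) :=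
  1 - ContinuousMap.const unitInterval (zetaC N ^ α.val) * γ.rootBranch N

theorem oneSub_ne_zero (N : ℕ) [NeZero N] (α : ZMod N) (t : unitInterval) : γ.oneSub N α t ≠ 0 := by
  intro h
  have h1 : zetaC N ^ α.val * γ.rootBranch N t = 1 := by
    have : 1 - zetaC N ^ α.val * γ.rootBranch N t = 0 := by simpa [oneSub] using h
    exact (sub_eq_zero.1 this).symm
  apply γ.ne_one t
  rw [← (γ.rootBranch_spec N).1 t]
  have h2 := congrArg (· ^ N) h1
  have h3 : (zetaC N ^ α.val) ^ N = 1 := by rw [← pow_mul, mul_comm, pow_mul, zetaC_pow, one_pow]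
  simpa [mul_pow, h3] using h2

theorem oneSub_zero (N : ℕ) [NeZero N] (α : ZMod N) : γ.oneSub N α 0 = 1 := by
  have h : γ.rootBranch N 0 = 0 := by
    have := (γ.rootBranch_spec N).1 0
    rw [γ.source] at this
    exact eq_zero_of_pow_eq_zero this
  simp [oneSub, h]

/-- The branch of `(1 - ζ_N ^ α * z ^ (1 / N)) ^ (1 / N)` along the path that has value `1`
at the start. -/
def oneSubRootBranch (N : ℕ) [NeZero N] (α : ZMod N) : C(unitInterval, ℂ) :=
  (existsUnique_root N (γ.oneSub N α) (γ.oneSub_ne_zero N α) (γ.oneSub_zero N α)).choose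

theorem oneSubRootBranch_spec (N : ℕ) [NeZero N] (α : ZMod N) :
    γ.oneSubRootBranch N α 0 = 1 ∧ ∀ t, γ.oneSubRootBranch N α t ^ N = γ.oneSub N α t :=
  (existsUnique_root N (γ.oneSub N α) (γ.oneSub_ne_zero N α) (γ.oneSub_zero N α)).choose_spec.1

end TangentialPath

/-! ### Elements of the algebraic closure and `ℓ`-adic characters -/

/-- The algebraic closure of `K` inside `ℂ`. -/
abbrev KBar (K : Type*) [Field K] [Algebra K ℂ] : IntermediateField K ℂ := algebraicClosure K ℂ

theorem mem_KBar_of_pow_mem {K : Type*} [Field K] [Algebra K ℂ] (N : ℕ) [NeZero N] {w : ℂ}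
    (h : w ^ N ∈ KBar K) : w ∈ KBar K := by
  rw [mem_algebraicClosure_iff] at h ⊢
  exact h.of_pow (Nat.pos_of_ne_zero (NeZero.ne N))

section Characters

variable {K : Type*} [Field K] [Algebra K ℂ]

variable (K) in
/-- `ζ_N = exp (2 π i / N)` as an element of the algebraic closure of `K` in `ℂ`. -/
def zetaBar (N : ℕ) [NeZero N] : KBar K :=
  ⟨zetaC N, mem_KBar_of_pow_mem N (by rw [zetaC_pow]; exact one_mem _)⟩

/-- The value `z ^ (1 / N)` at the end point of the path. -/
def rootAlong {z : K} (γ : TangentialPath (algebraMap K ℂ z)) (N : ℕ) [NeZero N] : KBar K :=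
  ⟨γ.rootBranch N 1, mem_KBar_of_pow_mem N (by
    rw [(γ.rootBranch_spec N).1, γ.target]; exact (KBar K).algebraMap_mem z)⟩

/-- The value of `(1 - ζ_N ^ α * z ^ (1 / N)) ^ (1 / N)` at the end point of the path. -/
def oneSubRootAlong {z : K} (γ : TangentialPath (algebraMap K ℂ z)) (N : ℕ) [NeZero N]
    (α : ZMod N) : KBar K :=
  ⟨γ.oneSubRootBranch N α 1, mem_KBar_of_pow_mem N (by
    rw [(γ.oneSubRootBranch_spec N α).2]
    have h : zetaC N ^ α.val * γ.rootBranch N 1 ∈ KBar K :=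
      mul_mem (pow_mem (zetaBar K N).2 _) (rootAlong γ N).2
    simpa [TangentialPath.oneSub] using sub_mem (one_mem _) h)⟩

variable (ℓ : ℕ) [Fact ℓ.Prime]

/-- `x ∈ ℤ_ℓ` is the exponent of the sequence `ε`: one has `ζ_{ℓ^n} ^ x = ε n` for all `n`. -/
def IsZetaExponent (ε : ℕ → KBar K) (x : ℤ_[ℓ]) : Prop :=
  ∀ n : ℕ, zetaBar K (ℓ ^ n) ^ (PadicInt.toZModPow n x).val = ε n

/-- An exponent is unique. -/
theorem IsZetaExponent.unique {ε : ℕ → KBar K} {x y : ℤ_[ℓ]} (hx : IsZetaExponent ℓ ε x)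
    (hy : IsZetaExponent ℓ ε y) : x = y := by
  refine PadicInt.ext_of_toZModPow.1 fun n => ZMod.val_injective _ ?_
  have hζ := Complex.isPrimitiveRoot_exp (ℓ ^ n) (NeZero.ne _)
  refine hζ.pow_inj (ZMod.val_lt _) (ZMod.val_lt _) ?_
  simpa [zetaBar, zetaC] using congrArg Subtype.val ((hx n).trans (hy n).symm)

open Classical in
/-- The exponent of the sequence `ε` (and `0` if it does not exist). -/
def zetaExponent (ε : ℕ → KBar K) : ℤ_[ℓ] :=
  if h : ∃ x, IsZetaExponent ℓ ε x then h.choose else 0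

theorem zetaExponent_spec {ε : ℕ → KBar K} (h : ∃ x, IsZetaExponent ℓ ε x) :
    IsZetaExponent ℓ ε (zetaExponent ℓ ε) := by
  rw [zetaExponent, dif_pos h]
  exact h.choose_spec

/-- A compatible sequence of `ℓ`-power roots of unity has an exponent. -/
theorem exists_isZetaExponent {ε : ℕ → KBar K} (h0 : ε 0 = 1) (h : ∀ n, ε (n + 1) ^ ℓ = ε n) :
    ∃ x, IsZetaExponent ℓ ε x := by
  have hε : ∀ n, ε n ^ ℓ ^ n = 1 := fun n => by
    induction n with
    | zero => simp [h0]
    | succ n ih => rw [pow_succ', pow_mul, h, ih]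
  have hζ : ∀ n, IsPrimitiveRoot (zetaBar K (ℓ ^ n)) (ℓ ^ n) := fun n =>
    IsPrimitiveRoot.of_map_of_injective (f := (KBar K).val)
      (Complex.isPrimitiveRoot_exp (ℓ ^ n) (NeZero.ne _)) (KBar K).val.injective
  have hζs : ∀ n, zetaBar K (ℓ ^ (n + 1)) ^ ℓ = zetaBar K (ℓ ^ n) := fun n => by
    refine Subtype.ext ?_
    change zetaC (ℓ ^ (n + 1)) ^ ℓ = zetaC (ℓ ^ n)
    rw [zetaC, zetaC, ← Complex.exp_nat_mul]
    have : (ℓ : ℂ) ≠ 0 := by exact_mod_cast NeZero.ne ℓ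
    congr 1
    push_cast
    rw [pow_succ']
    field_simp
  choose k hk hkε using fun n => (hζ n).eq_pow_of_pow_eq_one (hε n)
  have hdvd : ∀ i, (ℓ : ℤ) ^ i ∣ (k (i + 1) : ℤ) - k i := fun i => by
    have h1 : zetaBar K (ℓ ^ i) ^ k (i + 1) = zetaBar K (ℓ ^ i) ^ k i := by
      rw [hkε i, ← h i, ← hkε (i + 1), ← hζs, ← pow_mul, ← pow_mul, mul_comm]
    rw [← pow_mod_orderOf, ← (hζ i).eq_orderOf] at h1
    have h2 := (hζ i).pow_inj (Nat.mod_lt _ (Nat.pos_of_neZero _)) (hk i) h1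
    have h3 : k i ≡ k (i + 1) [MOD ℓ ^ i] := by
      rw [Nat.ModEq, h2, Nat.mod_eq_of_lt (hk i)]
    exact_mod_cast Nat.modEq_iff_dvd.1 h3
  refine ⟨PadicInt.ofIntSeq _
    (PadicInt.isCauSeq_padicNorm_of_pow_dvd_sub (fun n => (k n : ℤ)) ℓ hdvd), fun n => ?_⟩
  rw [PadicInt.toZModPow_ofIntSeq_of_pow_dvd_sub (fun n => (k n : ℤ)) ℓ hdvd n, ← hkε n]
  congr 1
  rw [Int.cast_natCast, ZMod.val_natCast, Nat.mod_eq_of_lt (hk n)]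

/-- The `ℓ`-adic cyclotomic character. -/
def cyclo (σ : Gal(KBar K/K)) : ℤ_[ℓ]ˣ := cyclotomicCharacter (KBar K) ℓ σ

/-- The Kummer `1`-cocycle of a system `w` of `ℓ`-power roots (`w n` is the chosen `ℓ^n`-th root):
`σ (w n) = ζ_{ℓ^n} ^ ρ(σ) * w n`. -/
def kummerChar (w : ℕ → KBar K) (σ : Gal(KBar K/K)) : ℤ_[ℓ] :=
  zetaExponent ℓ fun n => σ (w n) / w n

/-- For a compatible system of roots of a nonzero element of `K` the Kummer cocycle exists. -/
theorem kummerChar_spec {w : ℕ → KBar K} {c : K} (hc : c ≠ 0) (h0 : w 0 = algebraMap K _ c)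
    (hw : ∀ n, w (n + 1) ^ ℓ = w n) (σ : Gal(KBar K/K)) (n : ℕ) :
    σ (w n) = zetaBar K (ℓ ^ n) ^ (PadicInt.toZModPow n (kummerChar ℓ w σ)).val * w n := by
  have hne : ∀ n, w n ≠ 0 := fun n => by
    induction n with
    | zero => simpa [h0] using hc
    | succ n ih => exact fun h => ih (by rw [← hw n, h, zero_pow (NeZero.ne ℓ)])
  have hex : ∃ x, IsZetaExponent ℓ (fun n => σ (w n) / w n) x :=
    exists_isZetaExponent ℓ (by simp [h0, hc]) fun n => by
      rw [div_pow, ← map_pow, hw]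
  have := zetaExponent_spec ℓ hex n
  rw [kummerChar, this, div_mul_cancel₀ _ (hne n)]

/-- The Kummer `1`-cocycle `ρ_z` for the roots of `z` along the path `γ`. -/
def rho {z : K} (γ : TangentialPath (algebraMap K ℂ z)) (σ : Gal(KBar K/K)) : ℤ_[ℓ] :=
  kummerChar ℓ (fun n => rootAlong γ (ℓ ^ n)) σ

/-- The quotient
`σ (∏_{0 ≤ a < ℓ^n} (1 - ζ_{ℓ^n} ^ (χ(σ)⁻¹ a) z ^ (1 / ℓ^n)) ^ (a ^ (m - 1) / ℓ^n)) /
  ∏_{0 ≤ a < ℓ^n} (1 - ζ_{ℓ^n} ^ (a + ρ_z(σ)) z ^ (1 / ℓ^n)) ^ (a ^ (m - 1) / ℓ^n)`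
with all roots taken along the path (`m ≥ 1`, and `0 ^ 0 = 1`). -/
def polylogQuotient (m : ℕ) {z : K} (γ : TangentialPath (algebraMap K ℂ z)) (σ : Gal(KBar K/K))
    (n : ℕ) : KBar K :=
  σ (∏ a ∈ Finset.range (ℓ ^ n), oneSubRootAlong γ (ℓ ^ n)
      (PadicInt.toZModPow n (((cyclo ℓ σ)⁻¹ : ℤ_[ℓ]ˣ) : ℤ_[ℓ]) * a) ^ (a ^ (m - 1))) /
    ∏ a ∈ Finset.range (ℓ ^ n), oneSubRootAlong γ (ℓ ^ n)
      (a + PadicInt.toZModPow n (rho ℓ γ σ)) ^ (a ^ (m - 1))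

/-- The Kummer properties defining the value at `σ` of the `m`-th `ℓ`-adic polylogarithmic
character along `γ`. -/
def HasKummerProperties (m : ℕ) {z : K} (γ : TangentialPath (algebraMap K ℂ z))
    (σ : Gal(KBar K/K)) (x : ℤ_[ℓ]) : Prop :=
  IsZetaExponent ℓ (polylogQuotient ℓ m γ σ) x

/-- The `m`-th `ℓ`-adic polylogarithmic character along `γ`. -/
def polylogChar (m : ℕ) {z : K} (γ : TangentialPath (algebraMap K ℂ z))
    (σ : Gal(KBar K/K)) : ℤ_[ℓ] :=
  zetaExponent ℓ (polylogQuotient ℓ m γ σ)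

end Characters

/-- The positive real `N`-th root of `2`. -/
def rootTwo (N : ℕ) [NeZero N] : KBar ℚ :=
  ⟨(((2 : ℝ) ^ ((N : ℝ)⁻¹) : ℝ) : ℂ), mem_KBar_of_pow_mem N (by
    rw [← Complex.ofReal_pow, Real.rpow_inv_natCast_pow zero_le_two (NeZero.ne N)]
    exact_mod_cast (KBar ℚ).algebraMap_mem 2)⟩

/-- The Kummer `1`-cocycle `ρ_2` for the positive real roots of `2`. -/
def rhoTwo (ℓ : ℕ) [Fact ℓ.Prime] (σ : Gal(KBar ℚ/ℚ)) : ℤ_[ℓ] :=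
  kummerChar ℓ (fun n => rootTwo (ℓ ^ n)) σ

/-! ### A path through the upper half plane -/

/-- The path that follows the real axis from `0` to `1/2`, passes above `1` to the unit circle,
and then follows the positive half arc of the unit circle to `-1`. -/
def halfArc : TangentialPath (algebraMap ℚ ℂ (-1)) where
  toMap := ⟨fun t => ((min (2 * (t : ℝ)) 1 : ℝ) : ℂ) *
    Complex.exp (((Real.pi * max 0 ((4 * (t : ℝ) - 1) / 3) : ℝ) : ℂ) * Complex.I), by fun_prop⟩
  source := by simp
  target := by norm_num
  ne_zero t ht := by
    have h : (0 : ℝ) < t := lt_of_le_of_ne t.2.1 fun h => ht (Subtype.ext h.symm)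
    have h1 : (0 : ℝ) < min (2 * (t : ℝ)) 1 := by positivity
    exact mul_ne_zero (by exact_mod_cast h1.ne') (Complex.exp_ne_zero _)
  ne_one t h := by
    have h0 : (0 : ℝ) ≤ t := t.2.1
    have h0' : (t : ℝ) ≤ 1 := t.2.2
    have hm : (0 : ℝ) ≤ min (2 * (t : ℝ)) 1 := by positivity
    have h1 : min (2 * (t : ℝ)) 1 = 1 := by
      have h' := congrArg norm h
      rw [ContinuousMap.coe_mk, norm_mul, Complex.norm_exp_ofReal_mul_I, Complex.norm_real,
        Real.norm_of_nonneg hm] at h'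
      simpa using h'
    have h2 : 1 ≤ 2 * (t : ℝ) := min_eq_right_iff.1 h1
    have h3 : max 0 ((4 * (t : ℝ) - 1) / 3) = (4 * (t : ℝ) - 1) / 3 := max_eq_right (by linarith)
    have h4 := congrArg Complex.re h
    simp only [ContinuousMap.coe_mk, h1, h3, Complex.ofReal_one, one_mul,
      Complex.exp_ofReal_mul_I_re, Complex.one_re] at h4
    have h5 := Real.strictAntiOn_cos.injOn
      ⟨mul_nonneg Real.pi_pos.le (by linarith), by nlinarith [Real.pi_pos]⟩
      ⟨le_rfl, Real.pi_pos.le⟩ (h4.trans Real.cos_zero.symm)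
    nlinarith [Real.pi_pos]
  tangent := by
    have hev : ∀ᶠ t : unitInterval in 𝓝[≠] 0, (t : ℝ) < 1 / 4 :=
      (continuous_subtype_val.continuousAt.eventually_lt continuousAt_const
        (by norm_num)).filter_mono nhdsWithin_le_nhds
    refine tendsto_const_nhds.congr' ?_
    filter_upwards [hev, self_mem_nhdsWithin] with t ht ht0
    have h : (0 : ℝ) < t := lt_of_le_of_ne t.2.1 fun h => ht0 (Subtype.ext h.symm)
    have h1 : min (2 * (t : ℝ)) 1 = 2 * t := min_eq_left (by linarith)
    have h3 : max 0 ((4 * (t : ℝ) - 1) / 3) = 0 := max_eq_left (by linarith)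
    have h4 : ((t : ℝ) : ℂ) ≠ 0 := by exact_mod_cast h.ne'
    simp [h1, h3, abs_of_pos h, h4]

theorem halfArc_im_nonneg (t : unitInterval) : 0 ≤ (halfArc.toMap t).im := by
  have h0 : (0 : ℝ) ≤ t := t.2.1
  have h1 : (t : ℝ) ≤ 1 := t.2.2
  have hm : (0 : ℝ) ≤ min (2 * (t : ℝ)) 1 := by positivity
  have hx : max 0 ((4 * (t : ℝ) - 1) / 3) ≤ 1 := max_le (by norm_num) (by linarith)
  have hx0 : 0 ≤ max 0 ((4 * (t : ℝ) - 1) / 3) := le_max_left _ _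
  simp only [halfArc, ContinuousMap.coe_mk, Complex.im_ofReal_mul,
    Complex.exp_ofReal_mul_I_im]
  exact mul_nonneg hm (Real.sin_nonneg_of_nonneg_of_le_pi (by positivity)
    (by nlinarith [Real.pi_pos]))

end

/-! ### Explicit branches along paths in the closed upper half plane -/

/-! Put N = ℓ^n, ζ = ζ_N, ω = ζ_{2N²} and B_α = 2α + 1 - N for 0 ≤ α < N, and let y_α be the end
value of the branch of (1 - ζ^α z^{1/N})^{1/N}. In the closed upper half plane every branch is a
principal one up to a constant rotation, so z^{1/N} ends at ζ_{2N} and y_α is a positive real times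
exp(πi B_α/(2N²)) (`oneSubRootBranch_one_of_im_nonneg`). The positive factors of y_α and y_{-1-α}
agree, whence y_α = y_{-1-α} ω^{B_α}; moreover ∏ y_α is the positive N-th root of 2.

Let σ(ω) = ω^c. Then c ≡ χ(σ) mod N and 2ρ_z(σ) + 1 ≡ c mod 2N (`exists_pow_two_mul_sq`), so the
permutation e(α) = χα + ρ_z of ℤ/N commutes with α ↦ -1-α, and B_{e(α)} = c B_α - 2N k_α with
integers k_α. The N-th roots of unity P_α = σ(y_α)/y_{e(α)} satisfy P_α = P_{-1-α} ζ^{k_α}. Pairing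
α with -1-α gives (∏ P_α^α)² ∏ P_α = ζ^{-M}, M = ∑ k_α (N-1-α) (`sq_prod_pow_val_mul_prod`). Here ∏
P_α = ζ^{ρ_2(σ)}, and the c-th power of ∏ P_α^α is the dilogarithmic quotient. Comparing ∑ B² before
and after e gives 24cM ≡ c² - 1 mod N (`dvd_sum_mul_val_sub_sq_sub_one`). Hence 48 χ̃_2 + 24 χ ρ_2 +
χ² - 1 vanishes modulo every ℓ^n.

Existence of the character holds for every nonzero z: the distribution relation makes the quotients
a compatible system of roots of unity. -/

theorem mem_slitPlane_of_re_nonneg {w : ℂ} (h0 : w ≠ 0) (hre : 0 ≤ w.re) : w ∈ Complex.slitPlane := by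
  rw [Complex.mem_slitPlane_iff]
  by_contra! h
  exact h0 (Complex.ext (le_antisymm h.1 hre) h.2)

theorem cpow_eq_norm_mul_exp {w : ℂ} (hw : w ≠ 0) (N : ℕ) :
    w ^ ((N : ℂ)⁻¹) = ((‖w‖ ^ ((N : ℝ)⁻¹) : ℝ) : ℂ) * Complex.exp (w.arg / N * Complex.I) := by
  rw [Complex.cpow_def_of_ne_zero hw, Real.rpow_def_of_pos (norm_pos_iff.2 hw), Complex.ofReal_exp,
    ← Complex.exp_add, Complex.log]
  congr 1
  push_cast
  ring

/-- A nowhere vanishing continuous function whose values, multiplied by a constant, stay in the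
slit plane has its continuous `N`-th root given by the principal logarithm. -/
theorem root_eq_exp_log {N : ℕ} [NeZero N] {f u : C(unitInterval, ℂ)} {κ : ℂ} (h0 : f 0 = 1)
    (hf : ∀ t, κ * f t ∈ Complex.slitPlane) (hu0 : u 0 = 1) (hu : ∀ t, u t ^ N = f t)
    (t : unitInterval) :
    u t = Complex.exp ((Complex.log (κ * f t) - Complex.log κ) / N) := by
  have hne : ∀ t, κ * f t ≠ 0 := fun t => Complex.slitPlane_ne_zero (hf t)
  have hN : (N : ℂ) ≠ 0 := by exact_mod_cast NeZero.ne N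
  have hκ : κ ≠ 0 := fun h => hne 0 (by simp [h])
  have hcont : Continuous fun t => Complex.log (κ * f t) :=
    Continuous.clog (by fun_prop) hf
  let v : C(unitInterval, ℂ) :=
    ⟨fun t => Complex.exp ((Complex.log (κ * f t) - Complex.log κ) / N), by fun_prop⟩
  have hv : v 0 = 1 ∧ ∀ t, v t ^ N = f t := by
    refine ⟨by simp [v, h0], fun t => ?_⟩
    change Complex.exp _ ^ N = _
    rw [← Complex.exp_nat_mul, mul_div_cancel₀ _ hN, Complex.exp_sub, Complex.exp_log (hne t),
      Complex.exp_log hκ]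
    field_simp
  have := (existsUnique_root N f (fun t h => hne t (by simp [h])) h0).unique ⟨hu0, hu⟩ hv
  rw [this]
  rfl

namespace TangentialPath

variable {z : ℂ} (γ : TangentialPath z)

/-- Along a path in the closed upper half plane the branch of the `N`-th root is obtained from the
principal root in the right half plane. -/
theorem rootBranch_eq_of_im_nonneg (hγ : ∀ t, 0 ≤ (γ.toMap t).im) (N : ℕ) [NeZero N]
    (t : unitInterval) :
    γ.rootBranch N t =
      Complex.exp (Real.pi / 2 / N * Complex.I) * (-Complex.I * γ.toMap t) ^ ((N : ℂ)⁻¹) := by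
  have hN : (N : ℂ) ≠ 0 := by exact_mod_cast NeZero.ne N
  have hN' : (0 : ℝ) < N := by exact_mod_cast Nat.pos_of_neZero N
  have hre : ∀ t, 0 ≤ (-Complex.I * γ.toMap t).re := fun t => by simpa using hγ t
  have hne : ∀ t, t ≠ 0 → -Complex.I * γ.toMap t ≠ 0 := fun t ht =>
    mul_ne_zero (by simp) (γ.ne_zero t ht)
  -- Multiplication by -i carries the closed upper half plane to the closed right half plane, which
  -- meets the cut of the logarithm only in 0; the exponential prefactor undoes the rotation.
  -- Continuity at 0 needs the positive real part of the exponent.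
  let v : C(unitInterval, ℂ) := ⟨fun t => Complex.exp (Real.pi / 2 / N * Complex.I) *
    (-Complex.I * γ.toMap t) ^ ((N : ℂ)⁻¹), by
      refine continuous_const.mul (continuous_iff_continuousAt.2 fun t => ?_)
      have hpair : ContinuousAt (fun t => (-Complex.I * γ.toMap t, (N : ℂ)⁻¹)) t := by fun_prop
      by_cases ht : t = 0
      · subst ht
        have h1 : 0 < ((N : ℂ)⁻¹).re := by
          rw [← Complex.ofReal_natCast, ← Complex.ofReal_inv, Complex.ofReal_re]
          positivity
        have h2 := Complex.continuousAt_cpow_zero_of_re_pos h1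
        have h3 : (-Complex.I * γ.toMap 0, (N : ℂ)⁻¹) = (0, (N : ℂ)⁻¹) := by simp [γ.source]
        rw [← h3] at h2
        exact ContinuousAt.comp (f := fun t => (-Complex.I * γ.toMap t, (N : ℂ)⁻¹)) h2 hpair
      · exact ContinuousAt.cpow (by fun_prop) (by fun_prop)
          (mem_slitPlane_of_re_nonneg (hne t ht) (hre t))⟩
  have hv : γ.IsRootBranch N v := by
    refine ⟨fun t => ?_, ?_⟩
    · change (Complex.exp (Real.pi / 2 / N * Complex.I) *
        (-Complex.I * γ.toMap t) ^ ((N : ℂ)⁻¹)) ^ N = _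
      rw [mul_pow, Complex.cpow_nat_inv_pow _ (NeZero.ne N), ← Complex.exp_nat_mul]
      have : (N : ℂ) * (Real.pi / 2 / N * Complex.I) = Real.pi / 2 * Complex.I := by field_simp
      rw [this, Complex.exp_pi_div_two_mul_I, ← mul_assoc]
      simp
    -- The path tends to 0, where `arg` is useless, but the modulus cancels in v/‖v‖ and only the
    -- argument of the normalised direction remains, which has a limit.
    · have hlim : Filter.Tendsto (fun t => Complex.exp (Real.pi / 2 / N * Complex.I) *
          Complex.exp ((-Complex.I * (γ.toMap t / (‖γ.toMap t‖ : ℂ))).arg / N * Complex.I))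
          (𝓝[≠] 0) (𝓝 1) := by
        have h1 : Filter.Tendsto (fun t => -Complex.I * (γ.toMap t / (‖γ.toMap t‖ : ℂ)))
            (𝓝[≠] 0) (𝓝 (-Complex.I * 1)) := γ.tangent.const_mul _
        have h2 := (Complex.continuousAt_arg (x := -Complex.I * 1)
          (by simp [Complex.mem_slitPlane_iff])).tendsto.comp h1
        have h3 : (1 : ℂ) = Complex.exp (Real.pi / 2 / N * Complex.I) *
            Complex.exp ((-Complex.I * 1).arg / N * Complex.I) := by
          rw [mul_one, Complex.arg_neg_I, ← Complex.exp_add]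
          push_cast
          rw [show (Real.pi / 2 / N * Complex.I + -(Real.pi / 2) / N * Complex.I : ℂ) = 0 by ring,
            Complex.exp_zero]
        rw [h3]
        refine Filter.Tendsto.const_mul _ ?_
        refine (Complex.continuous_exp.tendsto _).comp (Filter.Tendsto.mul_const _ ?_)
        exact Filter.Tendsto.div_const ((Complex.continuous_ofReal.tendsto _).comp h2) _
      refine hlim.congr' ?_
      filter_upwards [self_mem_nhdsWithin] with t ht
      have hz : 0 < ‖γ.toMap t‖ := norm_pos_iff.2 (γ.ne_zero t ht)
      have hn : ‖-Complex.I * γ.toMap t‖ = ‖γ.toMap t‖ := by simp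
      have hs : 0 < ‖γ.toMap t‖ ^ ((N : ℝ)⁻¹) := Real.rpow_pos_of_pos hz _
      have harg : (-Complex.I * (γ.toMap t / (‖γ.toMap t‖ : ℂ))).arg
          = (-Complex.I * γ.toMap t).arg := by
        rw [← Complex.arg_real_mul (-Complex.I * γ.toMap t) (inv_pos.2 hz)]
        congr 1
        push_cast
        ring
      have hval : v t = ((‖γ.toMap t‖ ^ ((N : ℝ)⁻¹) : ℝ) : ℂ) *
          (Complex.exp (Real.pi / 2 / N * Complex.I) *
          Complex.exp ((-Complex.I * γ.toMap t).arg / N * Complex.I)) := by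
        change Complex.exp (Real.pi / 2 / N * Complex.I) *
          (-Complex.I * γ.toMap t) ^ ((N : ℂ)⁻¹) = _
        rw [cpow_eq_norm_mul_exp (hne t ht), hn]
        ring
      have hu : ∀ x : ℝ, ‖Complex.exp (x / N * Complex.I)‖ = 1 := fun x => by
        rw [← Complex.ofReal_natCast, ← Complex.ofReal_div, Complex.norm_exp_ofReal_mul_I]
      have hu' := hu (Real.pi / 2)
      push_cast at hu'
      rw [harg, hval, norm_mul, norm_mul, hu, hu', Complex.norm_real, Real.norm_of_nonneg hs.le]
      have : ((‖γ.toMap t‖ ^ ((N : ℝ)⁻¹) : ℝ) : ℂ) ≠ 0 := by exact_mod_cast hs.ne'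
      rw [mul_one, mul_one, mul_div_cancel_left₀ _ this]
  rw [(γ.existsUnique_isRootBranch N).unique (γ.rootBranch_spec N) hv]
  rfl

/-- The confinement of the argument to [0, π/N] is what locates 1 - ζ_N^α z^{1/N} relative to the
cut. -/
theorem exists_rootBranch_eq_of_im_nonneg (hγ : ∀ t, 0 ≤ (γ.toMap t).im) (N : ℕ) [NeZero N]
    (t : unitInterval) :
    ∃ s θ : ℝ, 0 ≤ s ∧ 0 ≤ θ ∧ θ ≤ Real.pi ∧
      γ.rootBranch N t = s * Complex.exp ((θ / N : ℝ) * Complex.I) := by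
  rw [γ.rootBranch_eq_of_im_nonneg hγ]
  by_cases h0 : -Complex.I * γ.toMap t = 0
  · exact ⟨0, 0, le_rfl, le_rfl, Real.pi_pos.le, by simp [h0, NeZero.ne N]⟩
  have hre : 0 ≤ (-Complex.I * γ.toMap t).re := by simpa using hγ t
  have harg := abs_le.1 (Complex.abs_arg_le_pi_div_two_iff.2 hre)
  refine ⟨‖-Complex.I * γ.toMap t‖ ^ ((N : ℝ)⁻¹), Real.pi / 2 + (-Complex.I * γ.toMap t).arg,
    by positivity, by linarith, by linarith, ?_⟩
  rw [cpow_eq_norm_mul_exp h0, mul_left_comm, ← Complex.exp_add]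
  congr 2
  push_cast
  ring

end TangentialPath

/-! ### Polar forms of 1 - w, and sums and products over residues -/

/-- Half-angle formula: extracting e^{iφ/2} leaves -2i sin(φ/2), and -i = e^{-iπ/2}. -/
theorem one_sub_exp_eq (φ : ℝ) :
    1 - Complex.exp (φ * Complex.I) =
      ((2 * Real.sin (φ / 2) : ℝ) : ℂ) * Complex.exp (((φ - Real.pi) / 2 : ℝ) * Complex.I) := by
  have h1 : Complex.exp (((φ - Real.pi) / 2 : ℝ) * Complex.I) =
      -Complex.I * Complex.exp ((φ / 2 : ℝ) * Complex.I) := by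
    rw [show (((φ - Real.pi) / 2 : ℝ) * Complex.I : ℂ)
      = (φ / 2 : ℝ) * Complex.I - Real.pi / 2 * Complex.I by push_cast; ring, Complex.exp_sub,
      Complex.exp_pi_div_two_mul_I, Complex.div_I]
    ring
  have h2 : Complex.exp (φ * Complex.I) = Complex.exp ((φ / 2 : ℝ) * Complex.I) ^ 2 := by
    rw [← Complex.exp_nat_mul]
    congr 1
    push_cast
    ring
  have h3 : Complex.exp ((φ / 2 : ℝ) * Complex.I) =
      (Real.cos (φ / 2) : ℂ) + (Real.sin (φ / 2) : ℂ) * Complex.I := by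
    rw [Complex.exp_mul_I, Complex.ofReal_cos, Complex.ofReal_sin]
  have h4 : (Real.sin (φ / 2) : ℂ) ^ 2 + (Real.cos (φ / 2) : ℂ) ^ 2 = 1 := by
    exact_mod_cast Real.sin_sq_add_cos_sq (φ / 2)
  rw [h1, h2, h3]
  push_cast at h4 ⊢
  linear_combination (-1 : ℂ) * h4 + Complex.sin (φ / 2) ^ 2 * Complex.I_sq

/-- A value in (-∞, 0] would force s e^{iψ} to be real and at least 1, hence ψ ∈ 2πℤ. -/
theorem one_sub_mul_exp_mem_slitPlane {s ψ : ℝ} (h0 : 0 < ψ) (h1 : ψ < 2 * Real.pi)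
    (hs : 0 ≤ s) : 1 - (s : ℂ) * Complex.exp (ψ * Complex.I) ∈ Complex.slitPlane := by
  rw [Complex.mem_slitPlane_iff]
  simp only [Complex.sub_re, Complex.one_re, Complex.re_ofReal_mul, Complex.exp_ofReal_mul_I_re,
    Complex.sub_im, Complex.one_im, Complex.im_ofReal_mul, Complex.exp_ofReal_mul_I_im]
  by_contra! h
  obtain ⟨hre, him⟩ := h
  have hs0 : s ≠ 0 := fun h => by simp [h] at hre; linarith
  have hsin : Real.sin ψ = 0 := by
    have : s * Real.sin ψ = 0 := by linarith
    exact (mul_eq_zero.1 this).resolve_left hs0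
  rcases Real.sin_eq_zero_iff_cos_eq.1 hsin with h | h
  · obtain ⟨k, hk⟩ := (Real.cos_eq_one_iff ψ).1 h
    have hk0 : (0 : ℝ) < k := by
      by_contra! hk0
      nlinarith [Real.pi_pos]
    have hk1 : (k : ℝ) < 1 := by
      by_contra! hk1
      nlinarith [Real.pi_pos]
    have hk0' : 0 < k := by exact_mod_cast hk0
    have hk1' : k < 1 := by exact_mod_cast hk1
    omega
  · rw [h] at hre
    linarith

theorem log_real_mul_exp {s ψ : ℝ} (hs : 0 < s) (h0 : -Real.pi < ψ) (h1 : ψ ≤ Real.pi) :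
    Complex.log (s * Complex.exp (ψ * Complex.I)) = Real.log s + ψ * Complex.I := by
  rw [Complex.log_ofReal_mul hs (Complex.exp_ne_zero _), Complex.log_exp] <;> simpa

theorem isPrimitiveRoot_zetaC (N : ℕ) [NeZero N] : IsPrimitiveRoot (zetaC N) N :=
  Complex.isPrimitiveRoot_exp N (NeZero.ne N)

theorem zetaC_pow_eq_exp (N k : ℕ) :
    zetaC N ^ k = Complex.exp ((2 * Real.pi * k / N : ℝ) * Complex.I) := by
  rw [zetaC, ← Complex.exp_nat_mul]
  congr 1
  push_cast
  ring

theorem prod_one_sub_pow_mul {R : Type*} [CommRing R] [IsDomain R] {ζ : R} {n : ℕ} [NeZero n]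
    (hζ : IsPrimitiveRoot ζ n) (y : R) : ∏ i ∈ Finset.range n, (1 - ζ ^ i * y) = 1 - y ^ n := by
  have h := hζ.pow_sub_pow_eq_prod_sub_mul 1 y (Nat.pos_of_neZero n)
  rw [one_pow] at h
  rw [h]
  refine Finset.prod_nbij (fun i => ζ ^ i) (fun i _ => ?_) (fun i hi j hj hij => ?_)
    (fun ξ hξ => ?_) fun i _ => rfl
  · rw [Polynomial.mem_nthRootsFinset (Nat.pos_of_neZero n), ← pow_mul, mul_comm, pow_mul,
      hζ.pow_eq_one, one_pow]
  · exact hζ.pow_inj (Finset.mem_range.1 hi) (Finset.mem_range.1 hj) hij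
  · obtain ⟨i, hi, rfl⟩ := hζ.eq_pow_of_pow_eq_one
      ((Polynomial.mem_nthRootsFinset (Nat.pos_of_neZero n) 1).1 hξ)
    exact ⟨i, by simpa using hi, rfl⟩

theorem prod_zmod_val {M : Type*} [CommMonoid M] (N : ℕ) [NeZero N] (f : ℕ → M) :
    ∏ α : ZMod N, f α.val = ∏ i ∈ Finset.range N, f i := by
  cases N with
  | zero => exact absurd rfl (NeZero.ne 0)
  | succ n => exact Fin.prod_univ_eq_prod_range f (n + 1)

theorem sum_zmod_val {M : Type*} [AddCommMonoid M] (N : ℕ) [NeZero N] (f : ℕ → M) :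
    ∑ α : ZMod N, f α.val = ∑ i ∈ Finset.range N, f i := by
  cases N with
  | zero => exact absurd rfl (NeZero.ne 0)
  | succ n => exact Fin.sum_univ_eq_sum_range f (n + 1)

/-- The involution α ↦ -1-α reverses the representatives 0, …, N-1. It corresponds to complex
conjugation of ζ_N^α ζ_{2N}, whose argument is (2α+1)π/N. -/
theorem val_neg_one_sub {N : ℕ} [NeZero N] (α : ZMod N) : (-1 - α).val + α.val + 1 = N := by
  have h := ZMod.val_lt α
  have h1 : -1 - α = ((N - 1 - α.val : ℕ) : ZMod N) := by
    rw [Nat.sub_sub, Nat.cast_sub (by omega)]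
    push_cast
    rw [ZMod.natCast_self, ZMod.natCast_zmod_val]
    ring
  rw [h1, ZMod.val_natCast, Nat.mod_eq_of_lt (by omega)]
  omega

theorem sum_two_mul_val_add_one_sub (N : ℕ) [NeZero N] :
    ∑ α : ZMod N, (2 * (α.val : ℤ) + 1 - N) = 0 := by
  rw [sum_zmod_val N fun i => 2 * (i : ℤ) + 1 - N]
  have : ∀ n : ℕ, ∑ i ∈ Finset.range n, (2 * (i : ℤ) + 1 - N) = n * (n - N) := fun n => by
    induction n with
    | zero => simp
    | succ n ih => rw [Finset.sum_range_succ, ih]; push_cast; ring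
  rw [this]
  ring

/-! ### End values of the branches at -1 -/

namespace TangentialPath

variable (γ : TangentialPath (algebraMap ℚ ℂ (-1)))

theorem rootBranch_one_of_im_nonneg (hγ : ∀ t, 0 ≤ (γ.toMap t).im) (N : ℕ) [NeZero N] :
    γ.rootBranch N 1 = Complex.exp ((Real.pi / N : ℝ) * Complex.I) := by
  have h : -Complex.I * γ.toMap 1 = Complex.I := by simp [γ.target]
  rw [γ.rootBranch_eq_of_im_nonneg hγ, h, cpow_eq_norm_mul_exp Complex.I_ne_zero, Complex.norm_I,
    Complex.arg_I, Real.one_rpow, Complex.ofReal_one, one_mul, ← Complex.exp_add]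
  congr 1
  push_cast
  ring

theorem rootBranch_one_eq_zetaC (hγ : ∀ t, 0 ≤ (γ.toMap t).im) (N : ℕ) [NeZero N] :
    γ.rootBranch N 1 = zetaC (2 * N) := by
  rw [γ.rootBranch_one_of_im_nonneg hγ, ← pow_one (zetaC _), zetaC_pow_eq_exp]
  congr 2
  push_cast
  field_simp

/-- At the end of a path to `-1` in the closed upper half plane, the branch of
`(1 - ζ_N ^ α * z ^ (1 / N)) ^ (1 / N)` is a positive multiple of an explicit root of unity. -/
theorem oneSubRootBranch_one_of_im_nonneg (hγ : ∀ t, 0 ≤ (γ.toMap t).im) (N : ℕ) [NeZero N]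
    (α : ZMod N) :
    0 < 2 * Real.sin (Real.pi * (2 * α.val + 1) / N / 2) ∧ γ.oneSubRootBranch N α 1 =
      (((2 * Real.sin (Real.pi * (2 * α.val + 1) / N / 2)) ^ ((N : ℝ)⁻¹) : ℝ) : ℂ) *
        Complex.exp ((Real.pi * (2 * α.val + 1 - N) / (2 * N ^ 2) : ℝ) * Complex.I) := by
  have hN : (0 : ℝ) < N := by exact_mod_cast Nat.pos_of_neZero N
  have hNC : (N : ℂ) ≠ 0 := by exact_mod_cast NeZero.ne N
  have hval : (α.val : ℝ) + 1 ≤ N := by exact_mod_cast ZMod.val_lt α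
  have hval0 : (0 : ℝ) ≤ α.val := by positivity
  have hπ := Real.pi_pos
  have hN1 : (1 : ℝ) ≤ N := by exact_mod_cast Nat.pos_of_neZero N
  set φ : ℝ := Real.pi * (2 * α.val + 1) / N with hφ
  have hφ0 : 0 < φ := by positivity
  have hφ1 : φ < 2 * Real.pi := by
    rw [hφ, div_lt_iff₀ hN]
    nlinarith
  have hsin : 0 < Real.sin (φ / 2) := Real.sin_pos_of_pos_of_lt_pi (by linarith) (by linarith)
  have hsin2 : 0 < 2 * Real.sin (φ / 2) := by linarith
  have heval : ∀ t, γ.oneSub N α t = 1 - zetaC N ^ α.val * γ.rootBranch N t := fun t => rfl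
  have hend : γ.oneSub N α 1 = ((2 * Real.sin (φ / 2) : ℝ) : ℂ) *
      Complex.exp (((φ - Real.pi) / 2 : ℝ) * Complex.I) := by
    rw [← one_sub_exp_eq, heval, γ.rootBranch_one_of_im_nonneg hγ, zetaC_pow_eq_exp,
      ← Complex.exp_add]
    congr 2
    rw [hφ]
    push_cast
    ring
  suffices h : γ.oneSubRootBranch N α 1 = Complex.exp
      ((Real.log (2 * Real.sin (φ / 2)) + ((φ - Real.pi) / 2 : ℝ) * Complex.I) / N) by
    refine ⟨hsin2, ?_⟩
    rw [h, Real.rpow_def_of_pos hsin2, Complex.ofReal_exp, ← Complex.exp_add]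
    congr 1
    rw [hφ]
    push_cast
    field_simp
  have hform : ∀ t, ∃ s θ : ℝ, 0 ≤ s ∧ 0 ≤ θ ∧ θ ≤ Real.pi ∧ γ.oneSub N α t =
      1 - s * Complex.exp ((2 * Real.pi * α.val / N + θ / N : ℝ) * Complex.I) := fun t => by
    obtain ⟨s, θ, hs, h0, h1, h⟩ := γ.exists_rootBranch_eq_of_im_nonneg hγ N t
    refine ⟨s, θ, hs, h0, h1, ?_⟩
    rw [heval, h, zetaC_pow_eq_exp, mul_left_comm, ← Complex.exp_add]
    congr 3
    push_cast
    ring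
  obtain ⟨hb0, hb⟩ := γ.oneSubRootBranch_spec N α
  -- For α = 0 the path may run along the real axis beyond 1, putting 1 - z^{1/N} on the cut, but
  -- its imaginary part is never positive, so the factor κ = i moves it to the right half plane. For
  -- α ≠ 0 the argument of ζ_N^α z^{1/N} lies strictly between 0 and 2π, and κ = 1 suffices.
  by_cases hα : α = 0
  · have hα' : (α.val : ℝ) = 0 := by simp [hα]
    have hφ' : φ ≤ Real.pi := by
      rw [hφ, hα', div_le_iff₀ hN]
      nlinarith
    have hslit : ∀ t, Complex.I * γ.oneSub N α t ∈ Complex.slitPlane := fun t => by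
      refine mem_slitPlane_of_re_nonneg (mul_ne_zero Complex.I_ne_zero (γ.oneSub_ne_zero N α t)) ?_
      obtain ⟨s, θ, hs, h0, h1, h⟩ := hform t
      rw [h, hα']
      simp only [Complex.I_mul_re, Complex.sub_im, Complex.one_im, Complex.im_ofReal_mul,
        Complex.exp_ofReal_mul_I_im]
      have : 0 ≤ Real.sin (2 * Real.pi * 0 / N + θ / N) := by
        refine Real.sin_nonneg_of_nonneg_of_le_pi (by positivity) ?_
        rw [mul_zero, zero_div, zero_add, div_le_iff₀ hN]
        nlinarith
      nlinarith [mul_nonneg hs this]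
    rw [root_eq_exp_log (γ.oneSub_zero N α) hslit hb0 hb, hend]
    have hI : Complex.I = Complex.exp ((Real.pi / 2 : ℝ) * Complex.I) := by
      push_cast
      rw [Complex.exp_pi_div_two_mul_I]
    have h2 : Complex.I * (((2 * Real.sin (φ / 2) : ℝ) : ℂ) *
        Complex.exp (((φ - Real.pi) / 2 : ℝ) * Complex.I)) =
        ((2 * Real.sin (φ / 2) : ℝ) : ℂ) * Complex.exp ((φ / 2 : ℝ) * Complex.I) := by
      rw [mul_left_comm]
      nth_rewrite 1 [hI]
      rw [← Complex.exp_add]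
      congr 2
      push_cast
      ring
    rw [h2, log_real_mul_exp hsin2 (by linarith) (by linarith), Complex.log_I]
    congr 2
    push_cast
    ring
  · have hα1 : (1 : ℝ) ≤ α.val := by
      exact_mod_cast Nat.pos_of_ne_zero fun h => hα ((ZMod.val_eq_zero α).1 h)
    have hslit : ∀ t, 1 * γ.oneSub N α t ∈ Complex.slitPlane := fun t => by
      obtain ⟨s, θ, hs, h0, h1, h⟩ := hform t
      rw [one_mul, h]
      refine one_sub_mul_exp_mem_slitPlane (by positivity) ?_ hs
      rw [← add_div, div_lt_iff₀ hN]
      nlinarith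
    rw [root_eq_exp_log (γ.oneSub_zero N α) hslit hb0 hb, one_mul, hend,
      log_real_mul_exp hsin2 (by linarith) (by linarith), Complex.log_one, sub_zero]

/-- The branches with exponents `α` and `-1 - α` are complex conjugate up to a root of unity. -/
theorem oneSubRootBranch_one_symm (hγ : ∀ t, 0 ≤ (γ.toMap t).im) (N : ℕ) [NeZero N]
    (α : ZMod N) :
    γ.oneSubRootBranch N α 1 = γ.oneSubRootBranch N (-1 - α) 1 *
      zetaC (2 * N ^ 2) ^ (2 * (α.val : ℤ) + 1 - N) := by
  have hN : (N : ℝ) ≠ 0 := by exact_mod_cast NeZero.ne N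
  have hNC : (N : ℂ) ≠ 0 := by exact_mod_cast NeZero.ne N
  have hv : ((-1 - α).val : ℝ) = N - 1 - α.val := by
    have : (((-1 - α).val + α.val + 1 : ℕ) : ℝ) = N := by rw [val_neg_one_sub]
    push_cast at this
    linarith
  have hs : Real.sin (Real.pi * (2 * (-1 - α).val + 1) / N / 2) =
      Real.sin (Real.pi * (2 * α.val + 1) / N / 2) := by
    rw [← Real.sin_pi_sub, hv]
    congr 1
    field_simp
    ring
  rw [(γ.oneSubRootBranch_one_of_im_nonneg hγ N α).2,
    (γ.oneSubRootBranch_one_of_im_nonneg hγ N (-1 - α)).2, hs, hv, zetaC, ← Complex.exp_int_mul,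
    mul_assoc, ← Complex.exp_add]
  congr 2
  push_cast
  field_simp
  ring

/-- The product of the branches is the positive root of `2`. -/
theorem prod_oneSubRootBranch_one (hγ : ∀ t, 0 ≤ (γ.toMap t).im) (N : ℕ) [NeZero N] :
    ∏ α : ZMod N, γ.oneSubRootBranch N α 1 = (((2 : ℝ) ^ ((N : ℝ)⁻¹) : ℝ) : ℂ) := by
  have hN := NeZero.ne N
  set R : ZMod N → ℝ := fun α =>
    (2 * Real.sin (Real.pi * (2 * α.val + 1) / N / 2)) ^ ((N : ℝ)⁻¹) with hR
  have hR0 : 0 ≤ ∏ α, R α := Finset.prod_nonneg fun α _ =>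
    Real.rpow_nonneg (γ.oneSubRootBranch_one_of_im_nonneg hγ N α).1.le _
  have hprod : ∏ α : ZMod N, γ.oneSubRootBranch N α 1 = ((∏ α, R α : ℝ) : ℂ) := by
    rw [Finset.prod_congr rfl fun α _ => (γ.oneSubRootBranch_one_of_im_nonneg hγ N α).2,
      Finset.prod_mul_distrib, ← Complex.exp_sum, ← Finset.sum_mul, ← Complex.ofReal_sum,
      ← Finset.sum_div, ← Finset.mul_sum]
    have h0 : ∑ α : ZMod N, (2 * (α.val : ℝ) + 1 - N) = 0 := by
      exact_mod_cast sum_two_mul_val_add_one_sub N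
    rw [h0]
    simp [hR]
  -- The phases have cancelled because ∑ B_α = 0; a nonnegative real is determined by its N-th
  -- power, which is 1 - z = 2.
  have hpow : (∏ α : ZMod N, γ.oneSubRootBranch N α 1) ^ N = 2 := by
    rw [← Finset.prod_pow, Finset.prod_congr rfl fun α _ => (γ.oneSubRootBranch_spec N α).2 1]
    change ∏ α : ZMod N, (1 - zetaC N ^ α.val * γ.rootBranch N 1) = 2
    rw [prod_zmod_val N fun i => 1 - zetaC N ^ i * γ.rootBranch N 1,
      prod_one_sub_pow_mul (isPrimitiveRoot_zetaC N), (γ.rootBranch_spec N).1, γ.target]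
    norm_num
  rw [hprod] at hpow ⊢
  have hpow' : (∏ α, R α) ^ N = 2 := by exact_mod_cast hpow
  congr 1
  rw [← hpow', Real.pow_rpow_inv_natCast hR0 hN]

end TangentialPath

/-! ### Distribution relations between levels N and Nl -/

theorem zetaC_mul_pow (N l : ℕ) [NeZero l] : zetaC (N * l) ^ l = zetaC N := by
  have : (l : ℂ) ≠ 0 := by exact_mod_cast NeZero.ne l
  rw [zetaC, zetaC, ← Complex.exp_nat_mul]
  congr 1
  push_cast
  field_simp

/-- The fibre of the reduction `ℤ/Nl → ℤ/N` over `α` consists of the classes of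
`α.val + N * j`, `0 ≤ j < l`. -/
theorem prod_fiber_castHom {M : Type*} [CommMonoid M] {N l N' : ℕ} [NeZero N] [NeZero N']
    (h : N' = N * l) (hd : N ∣ N') (α : ZMod N) (f : ℕ → M) :
    ∏ a : ZMod N' with ZMod.castHom hd (ZMod N) a = α, f a.val =
      ∏ j ∈ Finset.range l, f (α.val + N * j) := by
  have hα := ZMod.val_lt α
  have hlt : ∀ j < l, α.val + N * j < N' := fun j hj => by
    have : N * (j + 1) ≤ N * l := Nat.mul_le_mul_left N hj
    rw [h]
    nlinarith
  have hval : ∀ a : ZMod N', ZMod.castHom hd (ZMod N) a = α ↔ a.val % N = α.val := fun a => by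
    rw [ZMod.castHom_apply, ← ZMod.natCast_val, ← ZMod.val_natCast,
      (ZMod.val_injective N).eq_iff]
  symm
  refine Finset.prod_nbij (fun j => ((α.val + N * j : ℕ) : ZMod N')) (fun j hj => ?_)
    (fun i hi j hj hij => ?_) (fun a ha => ?_) (fun j hj => ?_)
  · have hj' := hlt j (Finset.mem_range.1 hj)
    rw [Finset.mem_filter, hval, ZMod.val_natCast, Nat.mod_eq_of_lt hj', Nat.add_mul_mod_self_left,
      Nat.mod_eq_of_lt hα]
    exact ⟨Finset.mem_univ _, rfl⟩
  · have hi' := hlt i (by simpa using hi)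
    have hj' := hlt j (by simpa using hj)
    have := congrArg ZMod.val hij
    simp only [ZMod.val_natCast, Nat.mod_eq_of_lt hi', Nat.mod_eq_of_lt hj'] at this
    exact Nat.eq_of_mul_eq_mul_left (Nat.pos_of_neZero N) (by omega)
  · have ha' : a.val % N = α.val := (hval a).1 (Finset.mem_filter.1 (Finset.mem_coe.1 ha)).2
    refine ⟨a.val / N, ?_, ?_⟩
    · simpa using Nat.div_lt_of_lt_mul ((ZMod.val_lt a).trans_eq h)
    · change ((α.val + N * (a.val / N) : ℕ) : ZMod N') = a
      rw [← ha', Nat.mod_add_div, ZMod.natCast_zmod_val]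
  · rw [ZMod.val_natCast, Nat.mod_eq_of_lt (hlt j (Finset.mem_range.1 hj))]

namespace TangentialPath

variable {z : ℂ} (γ : TangentialPath z)

theorem rootBranch_mul_pow {N l N' : ℕ} [NeZero N] [NeZero N'] (h : N' = N * l)
    (t : unitInterval) : γ.rootBranch N' t ^ l = γ.rootBranch N t := by
  have hv : γ.IsRootBranch N (γ.rootBranch N' ^ l) := by
    refine ⟨fun t => ?_, ?_⟩
    · rw [ContinuousMap.pow_apply, ← pow_mul, mul_comm, ← h, (γ.rootBranch_spec N').1]
    · have := (γ.rootBranch_spec N').2.pow l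
      rw [one_pow] at this
      refine this.congr fun t => ?_
      rw [ContinuousMap.pow_apply, norm_pow, div_pow, Complex.ofReal_pow]
  rw [(γ.existsUnique_isRootBranch N).unique (γ.rootBranch_spec N) hv, ContinuousMap.pow_apply]

/-- Distribution relation for the branches `(1 - ζ_N ^ α * z ^ (1 / N)) ^ (1 / N)`. -/
theorem prod_oneSubRootBranch_pow {N l N' : ℕ} [NeZero N] [NeZero N'] [NeZero l]
    (h : N' = N * l) (hd : N ∣ N') (α : ZMod N) (t : unitInterval) :
    ∏ a : ZMod N' with ZMod.castHom hd (ZMod N) a = α, γ.oneSubRootBranch N' a t ^ l =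
      γ.oneSubRootBranch N α t := by
  -- By uniqueness of the branch it suffices that u starts at 1 and has the right N-th power; the
  -- latter is the factorisation of 1 - y^l over the l-th roots of unity.
  let u : C(unitInterval, ℂ) :=
    ∏ a : ZMod N' with ZMod.castHom hd (ZMod N) a = α, γ.oneSubRootBranch N' a ^ l
  have hu : ∀ t, u t = ∏ a : ZMod N' with ZMod.castHom hd (ZMod N) a = α,
      γ.oneSubRootBranch N' a t ^ l := fun t => by
    simp [u, ContinuousMap.prod_apply]
  have hu' : u 0 = 1 ∧ ∀ t, u t ^ N = γ.oneSub N α t := by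
    refine ⟨?_, fun t => ?_⟩
    · rw [hu]
      exact Finset.prod_eq_one fun a _ => by rw [(γ.oneSubRootBranch_spec N' a).1, one_pow]
    · have h1 : u t ^ N = ∏ a : ZMod N' with ZMod.castHom hd (ZMod N) a = α,
          (1 - zetaC N' ^ a.val * γ.rootBranch N' t) := by
        rw [hu, ← Finset.prod_pow]
        refine Finset.prod_congr rfl fun a _ => ?_
        rw [← pow_mul, mul_comm l, ← h, (γ.oneSubRootBranch_spec N' a).2]
        rfl
      have hl : IsPrimitiveRoot (zetaC N' ^ N) l :=
        (isPrimitiveRoot_zetaC N').pow (NeZero.pos N') h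
      have h2 := prod_one_sub_pow_mul hl (zetaC N' ^ α.val * γ.rootBranch N' t)
      rw [mul_pow, γ.rootBranch_mul_pow h, ← pow_mul, mul_comm α.val, pow_mul] at h2
      rw [h1, prod_fiber_castHom h hd α fun i => 1 - zetaC N' ^ i * γ.rootBranch N' t]
      change _ = 1 - zetaC N ^ α.val * γ.rootBranch N t
      rw [show zetaC N = zetaC N' ^ l by rw [h, zetaC_mul_pow], ← h2]
      refine Finset.prod_congr rfl fun j _ => ?_
      rw [pow_add, pow_mul]
      ring
  rw [← hu, ← (existsUnique_root N (γ.oneSub N α) (γ.oneSub_ne_zero N α)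
    (γ.oneSub_zero N α)).unique hu' (γ.oneSubRootBranch_spec N α)]

end TangentialPath

theorem pow_eq_pow_of_zmod_eq {M : Type*} [Monoid M] {N : ℕ} {x : M} (hx : x ^ N = 1) {i j : ℕ}
    (h : (i : ZMod N) = j) : x ^ i = x ^ j :=
  pow_eq_pow_of_modEq ((ZMod.natCast_eq_natCast_iff i j N).1 h) hx

/-! ### Existence of the polylogarithmic characters -/

section Existence

variable {K : Type*} [Field K] [Algebra K ℂ]

theorem isPrimitiveRoot_zetaBar (N : ℕ) [NeZero N] : IsPrimitiveRoot (zetaBar K N) N :=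
  IsPrimitiveRoot.of_map_of_injective (f := (KBar K).val) (isPrimitiveRoot_zetaC N)
    (KBar K).val.injective

variable {z : K} (γ : TangentialPath (algebraMap K ℂ z))

theorem oneSubRootAlong_pow (N : ℕ) [NeZero N] (α : ZMod N) :
    oneSubRootAlong γ N α ^ N = 1 - zetaBar K N ^ α.val * rootAlong γ N :=
  Subtype.ext ((γ.oneSubRootBranch_spec N α).2 1)

theorem oneSubRootAlong_ne_zero (N : ℕ) [NeZero N] (α : ZMod N) : oneSubRootAlong γ N α ≠ 0 :=
  fun h => γ.oneSub_ne_zero N α 1 (by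
    rw [← (γ.oneSubRootBranch_spec N α).2, show γ.oneSubRootBranch N α 1 = 0 from
      congrArg Subtype.val h, zero_pow (NeZero.ne N)])

theorem rootAlong_pow (N : ℕ) [NeZero N] : rootAlong γ N ^ N = algebraMap K (KBar K) z :=
  Subtype.ext (((γ.rootBranch_spec N).1 1).trans γ.target)

theorem prod_oneSubRootAlong_pow {N l N' : ℕ} [NeZero N] [NeZero N'] [NeZero l]
    (h : N' = N * l) (hd : N ∣ N') (α : ZMod N) :
    ∏ a : ZMod N' with ZMod.castHom hd (ZMod N) a = α, oneSubRootAlong γ N' a ^ l =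
      oneSubRootAlong γ N α := by
  refine Subtype.ext ?_
  rw [← IntermediateField.coe_val, map_prod]
  exact γ.prod_oneSubRootBranch_pow h hd α 1

instance hasEnoughRootsOfUnity_KBar (N : ℕ) [NeZero N] : HasEnoughRootsOfUnity (KBar K) N where
  prim := ⟨zetaBar K N, isPrimitiveRoot_zetaBar N⟩
  cyc := rootsOfUnity.isCyclic (KBar K) N

variable (ℓ : ℕ) [Fact ℓ.Prime]

theorem map_zetaBar (σ : Gal(KBar K/K)) (n : ℕ) :
    σ (zetaBar K (ℓ ^ n)) =
      zetaBar K (ℓ ^ n) ^ (PadicInt.toZModPow n (cyclo ℓ σ : ℤ_[ℓ])).val := by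
  have := cyclotomicCharacter.spec ℓ (n := n) (σ : KBar K ≃+* KBar K) (zetaBar K (ℓ ^ n))
    (isPrimitiveRoot_zetaBar _).pow_eq_one
  exact this

theorem map_rootAlong (hz : z ≠ 0) (σ : Gal(KBar K/K)) (n : ℕ) :
    σ (rootAlong γ (ℓ ^ n)) =
      zetaBar K (ℓ ^ n) ^ (PadicInt.toZModPow n (rho ℓ γ σ)).val * rootAlong γ (ℓ ^ n) := by
  refine kummerChar_spec ℓ (w := fun n => rootAlong γ (ℓ ^ n)) hz ?_ (fun n => ?_) σ n
  · have h : rootAlong γ (ℓ ^ 0) ^ ℓ ^ 0 = rootAlong γ (ℓ ^ 0) :=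
      (congrArg (rootAlong γ (ℓ ^ 0) ^ ·) (pow_zero ℓ)).trans (pow_one _)
    exact h.symm.trans (rootAlong_pow γ (ℓ ^ 0))
  · exact Subtype.ext (γ.rootBranch_mul_pow (pow_succ ℓ n) 1)

/-- The factor at `a` of the quotient defining the polylogarithmic characters. -/
noncomputable def polylogFactor (σ : Gal(KBar K/K)) (n : ℕ) (a : ZMod (ℓ ^ n)) : KBar K :=
  σ (oneSubRootAlong γ (ℓ ^ n)
    (PadicInt.toZModPow n (((cyclo ℓ σ)⁻¹ : ℤ_[ℓ]ˣ) : ℤ_[ℓ]) * a)) /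
      oneSubRootAlong γ (ℓ ^ n) (a + PadicInt.toZModPow n (rho ℓ γ σ))

theorem polylogQuotient_eq_prod (m : ℕ) (σ : Gal(KBar K/K)) (n : ℕ) :
    polylogQuotient ℓ m γ σ n =
      ∏ a : ZMod (ℓ ^ n), polylogFactor γ ℓ σ n a ^ (a.val ^ (m - 1)) := by
  have := prod_zmod_val (ℓ ^ n) fun i => polylogFactor γ ℓ σ n i ^ (i ^ (m - 1))
  simp only [ZMod.natCast_zmod_val] at this
  rw [this, polylogQuotient, map_prod, ← Finset.prod_div_distrib]
  exact Finset.prod_congr rfl fun a _ => by rw [map_pow, polylogFactor, div_pow]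

theorem cyclo_inv_mul (σ : Gal(KBar K/K)) (n : ℕ) :
    PadicInt.toZModPow n (cyclo ℓ σ : ℤ_[ℓ]) *
      PadicInt.toZModPow n (((cyclo ℓ σ)⁻¹ : ℤ_[ℓ]ˣ) : ℤ_[ℓ]) = 1 := by
  rw [← map_mul, Units.mul_inv, map_one]

/-- Numerator and denominator are N-th roots of the same number 1 - ζ^{a+ρ} z^{1/N}: σ multiplies
the exponent χ⁻¹a by χ and shifts it by ρ. -/
theorem polylogFactor_pow (hz : z ≠ 0) (σ : Gal(KBar K/K)) (n : ℕ) (a : ZMod (ℓ ^ n)) :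
    polylogFactor γ ℓ σ n a ^ ℓ ^ n = 1 := by
  have hne : oneSubRootAlong γ (ℓ ^ n) (a + PadicInt.toZModPow n (rho ℓ γ σ)) ^ ℓ ^ n ≠ 0 :=
    pow_ne_zero _ (oneSubRootAlong_ne_zero γ _ _)
  rw [polylogFactor, div_pow, div_eq_one_iff_eq hne, ← map_pow, oneSubRootAlong_pow,
    oneSubRootAlong_pow, map_sub, map_mul, map_pow, map_one, map_zetaBar, map_rootAlong γ ℓ hz,
    ← mul_assoc, ← pow_mul, ← pow_add]
  congr 2
  refine pow_eq_pow_of_zmod_eq (isPrimitiveRoot_zetaBar _).pow_eq_one ?_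
  push_cast
  simp only [ZMod.natCast_zmod_val]
  rw [← mul_assoc, cyclo_inv_mul, one_mul]

theorem castHom_toZModPow (n : ℕ) (hd : ℓ ^ n ∣ ℓ ^ (n + 1)) (x : ℤ_[ℓ]) :
    ZMod.castHom hd (ZMod (ℓ ^ n)) (PadicInt.toZModPow (n + 1) x) = PadicInt.toZModPow n x :=
  RingHom.congr_fun (PadicInt.zmod_cast_comp_toZModPow n (n + 1) n.le_succ) x

/-- Multiplication by χ⁻¹ and translation by ρ commute with reduction, so they carry fibres to
fibres and the distribution relation applies to numerator and denominator separately. -/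
theorem prod_polylogFactor_pow (σ : Gal(KBar K/K)) (n : ℕ) (hd : ℓ ^ n ∣ ℓ ^ (n + 1))
    (b : ZMod (ℓ ^ n)) :
    ∏ a : ZMod (ℓ ^ (n + 1)) with ZMod.castHom hd (ZMod (ℓ ^ n)) a = b,
      polylogFactor γ ℓ σ (n + 1) a ^ ℓ = polylogFactor γ ℓ σ n b := by
  simp only [polylogFactor, div_pow]
  rw [Finset.prod_div_distrib, ← prod_oneSubRootAlong_pow γ (pow_succ ℓ n) hd,
    ← prod_oneSubRootAlong_pow γ (pow_succ ℓ n) hd, map_prod]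
  have h1 : IsUnit (PadicInt.toZModPow (n + 1) (((cyclo ℓ σ)⁻¹ : ℤ_[ℓ]ˣ) : ℤ_[ℓ])) :=
    (Units.isUnit _).map _
  have h0 : IsUnit (PadicInt.toZModPow n (((cyclo ℓ σ)⁻¹ : ℤ_[ℓ]ˣ) : ℤ_[ℓ])) :=
    (Units.isUnit _).map _
  congr 1
  · refine Finset.prod_equiv (Units.mulLeft h1.unit) (fun a => ?_) fun a _ => by simp
    simp only [Finset.mem_filter, Finset.mem_univ, true_and, Units.mulLeft_apply, IsUnit.unit_spec,
      map_mul, castHom_toZModPow]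
    exact h0.mul_right_inj.symm
  · refine Finset.prod_equiv (Equiv.addRight (PadicInt.toZModPow (n + 1) (rho ℓ γ σ)))
      (fun a => ?_) fun a _ => by simp
    simp only [Finset.mem_filter, Finset.mem_univ, true_and, Equiv.coe_addRight, map_add,
      castHom_toZModPow]
    exact (add_left_inj _).symm

theorem polylogQuotient_succ_pow (m : ℕ) (hz : z ≠ 0) (σ : Gal(KBar K/K)) (n : ℕ) :
    polylogQuotient ℓ m γ σ (n + 1) ^ ℓ = polylogQuotient ℓ m γ σ n := by
  have hd : ℓ ^ n ∣ ℓ ^ (n + 1) := pow_dvd_pow ℓ n.le_succ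
  rw [polylogQuotient_eq_prod, polylogQuotient_eq_prod, ← Finset.prod_pow,
    ← Finset.prod_fiberwise Finset.univ (ZMod.castHom hd (ZMod (ℓ ^ n)))]
  refine Finset.prod_congr rfl fun b _ => ?_
  rw [← prod_polylogFactor_pow γ ℓ σ n hd, ← Finset.prod_pow]
  refine Finset.prod_congr rfl fun a ha => ?_
  have hab : ZMod.castHom hd (ZMod (ℓ ^ n)) a = b := (Finset.mem_filter.1 ha).2
  rw [← pow_mul, mul_comm, pow_mul]
  -- The ℓ-th power of a factor is an ℓ^n-th root of unity, so the weight a^{m-1} matters only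
  -- modulo ℓ^n and is constant on the fibre.
  refine pow_eq_pow_of_zmod_eq (N := ℓ ^ n) ?_ ?_
  · rw [← pow_mul, ← pow_succ', polylogFactor_pow γ ℓ hz]
  · push_cast
    rw [ZMod.natCast_zmod_val, ← hab, ZMod.castHom_apply, ZMod.natCast_val]

/-- The polylogarithmic characters along a path to a nonzero point exist. -/
theorem hasKummerProperties_polylogChar (m : ℕ) (hz : z ≠ 0) (σ : Gal(KBar K/K)) :
    HasKummerProperties ℓ m γ σ (polylogChar ℓ m γ σ) := by
  refine zetaExponent_spec ℓ (exists_isZetaExponent ℓ ?_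
    (polylogQuotient_succ_pow γ ℓ m hz σ))
  rw [polylogQuotient_eq_prod]
  refine Finset.prod_eq_one fun a _ => ?_
  have := polylogFactor_pow γ ℓ hz σ 0 a
  rw [pow_zero, pow_one] at this
  rw [this, one_pow]

end Existence

/-! ### A Dedekind sum congruence and the pairing of α with -1-α -/

theorem three_mul_sum_sq_two_mul_val_add_one_sub (N : ℕ) [NeZero N] :
    3 * ∑ α : ZMod N, (2 * (α.val : ℤ) + 1 - N) ^ 2 = (N : ℤ) * ((N : ℤ) ^ 2 - 1) := by
  rw [sum_zmod_val N fun i => (2 * (i : ℤ) + 1 - N) ^ 2]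
  have : ∀ n : ℕ, 3 * ∑ i ∈ Finset.range n, (2 * (i : ℤ) + 1 - N) ^ 2 =
      (n : ℤ) * (4 * (n : ℤ) ^ 2 - 1 - 6 * n * N + 3 * (N : ℤ) ^ 2) := fun n => by
    induction n with
    | zero => simp
    | succ n ih => rw [Finset.sum_range_succ, mul_add, ih]; push_cast; ring
  rw [this]
  ring

/-- A congruence of Dedekind sum type for a permutation of `ℤ/N` that multiplies the centred
representatives by `c` up to multiples of `2 * N`. -/
theorem dvd_sum_mul_val_sub_sq_sub_one {N : ℕ} [NeZero N] {c : ℤ} (e : ZMod N ≃ ZMod N)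
    {k : ZMod N → ℤ}
    (hk : ∀ α, 2 * ((e α).val : ℤ) + 1 - N = c * (2 * (α.val : ℤ) + 1 - N) - 2 * N * k α) :
    (N : ℤ) ∣ 24 * c * ∑ α, k α * ((-1 - α).val : ℤ) - (c ^ 2 - 1) := by
  have hN : (N : ℤ) ≠ 0 := by exact_mod_cast NeZero.ne N
  have hB0 := sum_two_mul_val_add_one_sub N
  have hS3 := three_mul_sum_sq_two_mul_val_add_one_sub N
  set B : ZMod N → ℤ := fun α => 2 * (α.val : ℤ) + 1 - N with hB
  change ∑ α, B α = 0 at hB0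
  change 3 * ∑ α, B α ^ 2 = _ at hS3
  change ∀ α, B (e α) = c * B α - 2 * N * k α at hk
  have hk0 : ∑ α, k α = 0 := by
    have h1 : ∑ α, B (e α) = 0 := by rw [Equiv.sum_comp e B, hB0]
    simp only [hk] at h1
    rw [Finset.sum_sub_distrib, ← Finset.mul_sum, hB0, ← Finset.mul_sum] at h1
    have : 2 * (N : ℤ) * ∑ α, k α = 0 := by linarith
    exact (mul_eq_zero.1 this).resolve_left (by simpa using hN)
  -- A permutation preserves the sum of squares; expanding the square of c B - 2N k brings in the
  -- mixed sum ∑ k B, which is -2M.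
  have hsq : ∑ α, B α ^ 2 =
      c ^ 2 * ∑ α, B α ^ 2 - 4 * N * c * ∑ α, k α * B α + 4 * N ^ 2 * ∑ α, k α ^ 2 := by
    refine (Equiv.sum_comp e fun α => B α ^ 2).symm.trans ?_
    rw [Finset.mul_sum, Finset.mul_sum, Finset.mul_sum, ← Finset.sum_sub_distrib,
      ← Finset.sum_add_distrib]
    exact Finset.sum_congr rfl fun α _ => by rw [hk]; ring
  have hM : 2 * ∑ α, k α * ((-1 - α).val : ℤ) = -∑ α, k α * B α := by
    have h1 : ∀ α, 2 * (k α * ((-1 - α).val : ℤ)) = (N - 1) * k α - k α * B α := fun α => by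
      have : (((-1 - α).val + α.val + 1 : ℕ) : ℤ) = N := by rw [val_neg_one_sub]
      push_cast at this
      rw [hB]
      linear_combination 2 * k α * this
    rw [Finset.mul_sum, Finset.sum_congr rfl fun α _ => h1 α, Finset.sum_sub_distrib,
      ← Finset.mul_sum, hk0]
    ring
  -- The quotient comes from inserting 3 ∑ B² = N(N² - 1) into `hsq` and cancelling one factor N.
  refine ⟨-((c ^ 2 - 1) * N + 12 * ∑ α, k α ^ 2), mul_left_cancel₀ hN ?_⟩
  linear_combination 12 * N * c * hM - 3 * hsq - (c ^ 2 - 1) * hS3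

/-- Reindex one copy of the square by α ↦ -1-α. The exponents at α then add up to N - 1, and the
extra factor P_α completes P_α^N = 1, so only powers of ζ survive. -/
theorem sq_prod_pow_val_mul_prod {F : Type*} [Field F] {N : ℕ} [NeZero N] {ζ : F} (hζ : ζ ≠ 0)
    {P : ZMod N → F} (hP : ∀ α, P α ^ N = 1) {k : ZMod N → ℤ}
    (hk : ∀ α, P α = P (-1 - α) * ζ ^ k α) :
    (∏ α, P α ^ α.val) ^ 2 * ∏ α, P α = ζ ^ (-∑ α, k α * ((-1 - α).val : ℤ)) := by
  have hz : ∀ α, ζ ^ k α ≠ 0 := fun α => zpow_ne_zero _ hζ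
  have h1 : ∏ α, P α ^ α.val = ∏ α, P (-1 - α) ^ (-1 - α).val :=
    (Equiv.prod_comp (Equiv.subLeft (-1 : ZMod N)) fun α => P α ^ α.val).symm
  rw [sq]
  nth_rewrite 2 [h1]
  rw [← Finset.prod_mul_distrib, ← Finset.prod_mul_distrib]
  have h2 : ∀ s : Finset (ZMod N), ζ ^ (-∑ α ∈ s, k α * ((-1 - α).val : ℤ)) =
      ∏ α ∈ s, ζ ^ (-(k α * ((-1 - α).val : ℤ))) := fun s => by
    classical
    induction s using Finset.induction_on with
    | empty => simp
    | insert a s ha ih =>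
      rw [Finset.sum_insert ha, Finset.prod_insert ha, neg_add, zpow_add₀ hζ, ih]
  rw [h2]
  refine Finset.prod_congr rfl fun α _ => ?_
  have h3 : P (-1 - α) = P α * (ζ ^ k α)⁻¹ := by
    rw [hk α, mul_assoc, mul_inv_cancel₀ (hz α), mul_one]
  have h4 : P α ^ α.val * P α ^ (-1 - α).val * P α = 1 := by
    rw [← pow_add, ← pow_succ, add_comm α.val, val_neg_one_sub, hP]
  rw [h3, mul_pow, inv_pow, ← zpow_natCast (ζ ^ k α), ← zpow_mul, zpow_neg]
  linear_combination (ζ ^ (k α * ((-1 - α).val : ℤ)))⁻¹ * h4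

theorem IsPrimitiveRoot.dvd_sub_of_zpow_eq {F : Type*} [Field F] {ζ : F} {N : ℕ} [NeZero N]
    (hζ : IsPrimitiveRoot ζ N) {i j : ℤ} (h : ζ ^ i = ζ ^ j) : (N : ℤ) ∣ i - j := by
  have h0 : ζ ≠ 0 := hζ.ne_zero (NeZero.ne N)
  rw [← hζ.zpow_eq_one_iff_dvd, zpow_sub₀ h0, h, div_self (zpow_ne_zero _ h0)]

theorem zetaBar_pow_of_eq_mul {K : Type*} [Field K] [Algebra K ℂ] {N l M : ℕ} [NeZero N]
    [NeZero l] [NeZero M] (h : M = N * l) : zetaBar K M ^ l = zetaBar K N := by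
  subst h
  exact Subtype.ext (zetaC_mul_pow N l)

/-- The absolute Galois group of `K`, for the algebraic closure of `K` inside `ℂ`. -/
abbrev GalKBar (K : Type*) [Field K] [Algebra K ℂ] := Gal(KBar K/K)

/-! ### Galois action and evaluation at -1 -/

section NegOne

variable (γ : TangentialPath (algebraMap ℚ ℂ (-1)))

theorem rootAlong_eq_zetaBar (hγ : ∀ t, 0 ≤ (γ.toMap t).im) (N : ℕ) [NeZero N] :
    rootAlong γ N = zetaBar ℚ (2 * N) :=
  Subtype.ext (γ.rootBranch_one_eq_zetaC hγ N)

theorem oneSubRootAlong_symm (hγ : ∀ t, 0 ≤ (γ.toMap t).im) (N : ℕ) [NeZero N] (α : ZMod N) :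
    oneSubRootAlong γ N α = oneSubRootAlong γ N (-1 - α) *
      zetaBar ℚ (2 * N ^ 2) ^ (2 * (α.val : ℤ) + 1 - N) := by
  refine Subtype.ext ?_
  rw [← IntermediateField.coe_val, map_mul, map_zpow₀]
  exact γ.oneSubRootBranch_one_symm hγ N α

theorem prod_oneSubRootAlong (hγ : ∀ t, 0 ≤ (γ.toMap t).im) (N : ℕ) [NeZero N] :
    ∏ α : ZMod N, oneSubRootAlong γ N α = rootTwo N := by
  refine Subtype.ext ?_
  rw [← IntermediateField.coe_val, map_prod]
  exact γ.prod_oneSubRootBranch_one hγ N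

theorem map_rootTwo (ℓ : ℕ) [Fact ℓ.Prime] (σ : GalKBar ℚ) (n : ℕ) :
    σ (rootTwo (ℓ ^ n)) =
      zetaBar ℚ (ℓ ^ n) ^ (PadicInt.toZModPow n (rhoTwo ℓ σ)).val * rootTwo (ℓ ^ n) := by
  refine kummerChar_spec ℓ (w := fun n => rootTwo (ℓ ^ n)) (c := 2) two_ne_zero ?_ (fun n => ?_) σ n
  · refine Subtype.ext ?_
    simp only [rootTwo, pow_zero, Nat.cast_one, inv_one, Real.rpow_one]
    exact (map_ofNat (algebraMap ℚ ℂ) 2).symm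
  · refine Subtype.ext ?_
    have hℓ : (ℓ : ℝ) ≠ 0 := by exact_mod_cast NeZero.ne ℓ
    simp only [rootTwo, SubmonoidClass.mk_pow]
    rw [← Complex.ofReal_pow, ← Real.rpow_natCast, ← Real.rpow_mul zero_le_two]
    congr 2
    push_cast
    rw [pow_succ]
    field_simp

/-- One exponent c, for the roots of unity of order 2N² occurring as ratios of conjugate branches,
controls both x and r: ζ_N and ζ_{2N} are powers of ζ_{2N²}. It is odd, being prime to 2N². -/
theorem exists_pow_two_mul_sq {K : Type*} [Field K] [Algebra K ℂ] (σ : Gal(KBar K/K)) {N : ℕ}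
    [NeZero N] {r x : ZMod N} (hx : σ (zetaBar K N) = zetaBar K N ^ x.val)
    (hr : σ (zetaBar K (2 * N)) = zetaBar K N ^ r.val * zetaBar K (2 * N)) :
    ∃ c : ℕ, Odd c ∧ σ (zetaBar K (2 * N ^ 2)) = zetaBar K (2 * N ^ 2) ^ c ∧ (c : ZMod N) = x ∧
      2 * (N : ℤ) ∣ 2 * (r.val : ℤ) + 1 - c := by
  have hω := isPrimitiveRoot_zetaBar (K := K) (2 * N ^ 2)
  have hσω := hω.map_of_injective σ.injective
  obtain ⟨c, -, hc⟩ := hω.eq_pow_of_pow_eq_one hσω.pow_eq_one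
  have h2N : zetaBar K (2 * N ^ 2) ^ N = zetaBar K (2 * N) := zetaBar_pow_of_eq_mul (by ring)
  have hN : zetaBar K (2 * N ^ 2) ^ (2 * N) = zetaBar K N := zetaBar_pow_of_eq_mul (by ring)
  have hcop : c.Coprime (2 * N ^ 2) :=
    (hω.pow_iff_coprime (Nat.pos_of_neZero _) c).1 (by rw [hc]; exact hσω)
  refine ⟨c, Nat.coprime_two_right.1 hcop.coprime_mul_right_right, hc.symm, ?_, ?_⟩
  · have h1 : zetaBar K N ^ (c : ℤ) = zetaBar K N ^ (x.val : ℤ) := by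
      rw [zpow_natCast, zpow_natCast, ← hx, ← hN, map_pow, ← hc, ← pow_mul, ← pow_mul,
        mul_comm (2 * N)]
    have h2 := (ZMod.intCast_eq_intCast_iff_dvd_sub _ _ N).2
      ((isPrimitiveRoot_zetaBar N).dvd_sub_of_zpow_eq h1.symm)
    simpa using h2
  -- Both sides are σ(ζ_{2N}). The congruence 2Nr + N ≡ cN mod 2N² may be divided by N, leaving the
  -- modulus 2N rather than N.
  · have h1 : zetaBar K (2 * N ^ 2) ^ ((2 * N * r.val + N : ℕ) : ℤ) =
        zetaBar K (2 * N ^ 2) ^ ((c * N : ℕ) : ℤ) := by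
      rw [zpow_natCast, zpow_natCast, pow_add, pow_mul, hN, h2N, ← hr, ← h2N, map_pow, ← hc,
        ← pow_mul]
    obtain ⟨q, hq⟩ := hω.dvd_sub_of_zpow_eq h1
    refine ⟨q, mul_left_cancel₀ (show (N : ℤ) ≠ 0 by exact_mod_cast NeZero.ne N) ?_⟩
    push_cast at hq
    linear_combination hq

variable (γ : TangentialPath (algebraMap ℚ ℂ (-1)))

/-- Evaluation of the dilogarithmic quotient at `-1` modulo `N`. -/
theorem fortyEight_mul_exponent_eq {N : ℕ} [NeZero N] (hγ : ∀ t, 0 ≤ (γ.toMap t).im)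
    (σ : GalKBar ℚ) {r x x' s w : ZMod N} {c : ℕ} (hodd : Odd c)
    (hω : σ (zetaBar ℚ (2 * N ^ 2)) = zetaBar ℚ (2 * N ^ 2) ^ c) (hcx : (c : ZMod N) = x)
    (hcr : 2 * (N : ℤ) ∣ 2 * (r.val : ℤ) + 1 - c) (hx1 : x * x' = 1)
    (h2 : σ (rootTwo N) = zetaBar ℚ N ^ s.val * rootTwo N)
    (hfac : ∀ a, (σ (oneSubRootAlong γ N (x' * a)) / oneSubRootAlong γ N (a + r)) ^ N = 1)
    (hy : zetaBar ℚ N ^ w.val =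
      ∏ a, (σ (oneSubRootAlong γ N (x' * a)) / oneSubRootAlong γ N (a + r)) ^ a.val) :
    48 * w + 24 * x * s + (x ^ 2 - 1) = 0 := by
  have hζ := isPrimitiveRoot_zetaBar (K := ℚ) N
  have hζ0 : zetaBar ℚ N ≠ 0 := hζ.ne_zero (NeZero.ne _)
  have hω0 : zetaBar ℚ (2 * N ^ 2) ≠ 0 := (isPrimitiveRoot_zetaBar _).ne_zero (NeZero.ne _)
  have hωN : zetaBar ℚ (2 * N ^ 2) ^ (2 * N) = zetaBar ℚ N := zetaBar_pow_of_eq_mul (by ring)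
  have hx'1 : x' * x = 1 := by rw [mul_comm, hx1]
  -- The substitution a = xα removes the inverse character from the numerator and turns the index a
  -- + r of the denominator into e(α).
  let m : ZMod N ≃ ZMod N := ⟨(x * ·), (x' * ·),
    fun a => by simp [← mul_assoc, hx'1], fun a => by simp [← mul_assoc, hx1]⟩
  let e : ZMod N ≃ ZMod N := m.trans (Equiv.addRight r)
  have hm : ∀ α, m α = x * α := fun α => rfl
  have he : ∀ α, e α = x * α + r := fun α => rfl
  have h2r : x = 2 * r + 1 := by
    have h := (ZMod.intCast_zmod_eq_zero_iff_dvd _ N).2 ((dvd_mul_left (N : ℤ) 2).trans hcr)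
    push_cast at h
    rw [ZMod.natCast_zmod_val, hcx] at h
    linear_combination -h
  have hesymm : ∀ α, e (-1 - α) = -1 - e α := fun α => by
    rw [he, he]
    linear_combination -h2r
  have hk : ∀ α, ∃ k : ℤ, 2 * ((e α).val : ℤ) + 1 - N =
      c * (2 * (α.val : ℤ) + 1 - N) - 2 * N * k := fun α => by
    have h1 : (N : ℤ) ∣ (c * α.val + r.val : ℤ) - (e α).val := by
      rw [← ZMod.intCast_zmod_eq_zero_iff_dvd]
      push_cast
      rw [ZMod.natCast_zmod_val, ZMod.natCast_zmod_val, ZMod.natCast_zmod_val, hcx, he, sub_self]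
    obtain ⟨q, hq⟩ := h1
    obtain ⟨q', hq'⟩ := hcr
    obtain ⟨d, hd⟩ := hodd
    -- The difference to be divided by 2N is 2(cα + r - e(α)) - (2r + 1 - c) - N(c - 1); oddness of
    -- c handles the last term.
    refine ⟨q - q' - d, ?_⟩
    have hd' : (c : ℤ) = 2 * d + 1 := by exact_mod_cast hd
    linear_combination (-2 : ℤ) * hq + hq' + (N : ℤ) * hd'
  choose k hk using hk
  set P : ZMod N → KBar ℚ := fun α =>
    σ (oneSubRootAlong γ N α) / oneSubRootAlong γ N (e α) with hPdef
  have hPm : ∀ a, σ (oneSubRootAlong γ N (x' * a)) / oneSubRootAlong γ N (a + r) =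
      P (m.symm a) := fun a => by
    change _ = σ (oneSubRootAlong γ N (x' * a)) / oneSubRootAlong γ N (x * (x' * a) + r)
    rw [← mul_assoc, hx1, one_mul]
  have hP : ∀ α, P α ^ N = 1 := fun α => by
    have := hfac (m α)
    rwa [hPm, Equiv.symm_apply_apply] at this
  have hPk : ∀ α, P α = P (-1 - α) * zetaBar ℚ N ^ k α := fun α => by
    have h1 : zetaBar ℚ N ^ k α * zetaBar ℚ (2 * N ^ 2) ^ (2 * ((e α).val : ℤ) + 1 - N) =
        (zetaBar ℚ (2 * N ^ 2) ^ c) ^ (2 * (α.val : ℤ) + 1 - N) := by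
      rw [← hωN, hk α, ← zpow_natCast, ← zpow_natCast, ← zpow_mul, ← zpow_mul, ← zpow_add₀ hω0]
      congr 1
      push_cast
      ring
    simp only [hPdef]
    rw [hesymm, oneSubRootAlong_symm γ hγ N α, oneSubRootAlong_symm γ hγ N (e α), map_mul,
      map_zpow₀, hω, ← h1]
    have h3 := oneSubRootAlong_ne_zero γ N (-1 - e α)
    have h4 := zpow_ne_zero (2 * ((e α).val : ℤ) + 1 - N) hω0
    field_simp
  have hT := sq_prod_pow_val_mul_prod hζ0 hP hPk
  have hprod : ∏ α, P α = zetaBar ℚ N ^ s.val := by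
    have h0 : rootTwo N ≠ 0 := by
      rw [← prod_oneSubRootAlong γ hγ N]
      exact Finset.prod_ne_zero_iff.2 fun α _ => oneSubRootAlong_ne_zero γ N α
    rw [hPdef, Finset.prod_div_distrib, ← map_prod,
      Equiv.prod_comp e fun α => oneSubRootAlong γ N α, prod_oneSubRootAlong γ hγ, h2,
      mul_div_cancel_right₀ _ h0]
  -- After a = xα the weight is xα ≡ cα mod N, and P_α is an N-th root of unity.
  have hε : zetaBar ℚ N ^ w.val = (∏ α, P α ^ α.val) ^ c := by
    rw [hy, ← Equiv.prod_comp m, ← Finset.prod_pow]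
    refine Finset.prod_congr rfl fun α _ => ?_
    rw [hPm, Equiv.symm_apply_apply, ← pow_mul]
    refine pow_eq_pow_of_zmod_eq (hP α) ?_
    push_cast
    simp only [ZMod.natCast_zmod_val]
    rw [hm, hcx, mul_comm]
  have hdvd := dvd_sum_mul_val_sub_sq_sub_one e hk
  rw [hprod] at hT
  set M := ∑ α, k α * ((-1 - α).val : ℤ)
  -- The pairing identity is raised to the power 24c and `hε` to the power 48, so that M enters as
  -- 24cM. Nothing is divided, so ℓ = 2 and ℓ = 3 are included.
  have hpow : zetaBar ℚ N ^ (48 * (w.val : ℤ) + 24 * c * s.val) =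
      zetaBar ℚ N ^ (-(24 * c * M)) := by
    have h1 := congrArg (· ^ (24 * c)) hT
    have h3 := congrArg (· ^ 48) hε
    simp only [mul_pow, ← pow_mul] at h1 h3
    have h4 : 2 * (24 * c) = c * 48 := by ring
    rw [h4, ← h3, ← zpow_natCast, ← zpow_natCast, ← zpow_natCast, ← zpow_add₀ hζ0,
      ← zpow_mul] at h1
    convert h1 using 2 <;> push_cast <;> ring
  have h5 := (hζ.dvd_sub_of_zpow_eq hpow).sub hdvd
  rw [← ZMod.intCast_zmod_eq_zero_iff_dvd] at h5
  push_cast at h5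
  rw [ZMod.natCast_zmod_val, ZMod.natCast_zmod_val, hcx] at h5
  linear_combination h5

theorem toZModPow_eq_of_hasKummerProperties (ℓ : ℕ) [Fact ℓ.Prime]
    (hγ : ∀ t, 0 ≤ (γ.toMap t).im) (σ : GalKBar ℚ) {y : ℤ_[ℓ]}
    (hy : HasKummerProperties ℓ 2 γ σ y) (n : ℕ) :
    PadicInt.toZModPow n (48 * y + 24 * (cyclo ℓ σ : ℤ_[ℓ]) * rhoTwo ℓ σ +
      ((cyclo ℓ σ : ℤ_[ℓ]) ^ 2 - 1)) = 0 := by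
  have hroot := map_rootAlong γ ℓ (by norm_num) σ n
  rw [rootAlong_eq_zetaBar γ hγ] at hroot
  obtain ⟨c, hodd, hω, hcx, hcr⟩ := exists_pow_two_mul_sq σ (map_zetaBar ℓ σ n) hroot
  have hy' : _ = polylogQuotient ℓ 2 γ σ n := hy n
  rw [polylogQuotient_eq_prod] at hy'
  simp only [Nat.reduceSub, pow_one] at hy'
  rw [map_add, map_add, map_mul, map_mul, map_mul, map_sub, map_pow, map_one, map_ofNat,
    map_ofNat]
  exact fortyEight_mul_exponent_eq γ hγ σ hodd hω hcx hcr (cyclo_inv_mul ℓ σ n)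
    (map_rootTwo ℓ σ n) (polylogFactor_pow γ ℓ (by norm_num) σ n) hy'

/-- The dilogarithmic character at `-1` along a path in the closed upper half plane. -/
theorem hasKummerProperties_and_polylogChar_eq (ℓ : ℕ) [Fact ℓ.Prime]
    (hγ : ∀ t, 0 ≤ (γ.toMap t).im) (σ : GalKBar ℚ) :
    HasKummerProperties ℓ 2 γ σ (polylogChar ℓ 2 γ σ) ∧
      ((polylogChar ℓ 2 γ σ : ℤ_[ℓ]) : ℚ_[ℓ]) =
        -((((cyclo ℓ σ : ℤ_[ℓ]ˣ) : ℤ_[ℓ]) : ℚ_[ℓ]) ^ 2 - 1) / 48 -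
          1 / 2 * (((cyclo ℓ σ : ℤ_[ℓ]ˣ) : ℤ_[ℓ]) : ℚ_[ℓ]) * ((rhoTwo ℓ σ : ℤ_[ℓ]) : ℚ_[ℓ]) := by
  have hK := hasKummerProperties_polylogChar γ ℓ 2 (by norm_num) σ
  refine ⟨hK, ?_⟩
  have h : 48 * polylogChar ℓ 2 γ σ + 24 * (cyclo ℓ σ : ℤ_[ℓ]) * rhoTwo ℓ σ +
      ((cyclo ℓ σ : ℤ_[ℓ]) ^ 2 - 1) = 0 :=
    -- The congruences at all levels give an identity in ℤ_ℓ, where 48 need not be a unit; the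
    -- division by 48 takes place in ℚ_ℓ.
    PadicInt.ext_of_toZModPow.1 fun n => by
      rw [toZModPow_eq_of_hasKummerProperties γ ℓ hγ σ hK n, map_zero]
  have h' := congrArg (fun x : ℤ_[ℓ] => (x : ℚ_[ℓ])) h
  have h48 : ((48 : ℤ_[ℓ]) : ℚ_[ℓ]) = 48 := map_ofNat PadicInt.Coe.ringHom 48
  have h24 : ((24 : ℤ_[ℓ]) : ℚ_[ℓ]) = 24 := map_ofNat PadicInt.Coe.ringHom 24
  push_cast at h'
  rw [h48, h24] at h'
  linear_combination h' / 48

end NegOne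

theorem mainTheorem9 (ℓ : ℕ) [Fact ℓ.Prime] (γ : TangentialPath (algebraMap ℚ ℂ (-1)))
    (hγ : ∀ t, 0 ≤ (γ.toMap t).im) (σ : Gal(KBar ℚ/ℚ)) :
    HasKummerProperties ℓ 2 γ σ (polylogChar ℓ 2 γ σ) ∧
      ((polylogChar ℓ 2 γ σ : ℤ_[ℓ]) : ℚ_[ℓ]) =
        -((((cyclo ℓ σ : ℤ_[ℓ]ˣ) : ℤ_[ℓ]) : ℚ_[ℓ]) ^ 2 - 1) / 48 -
          1 / 2 * (((cyclo ℓ σ : ℤ_[ℓ]ˣ) : ℤ_[ℓ]) : ℚ_[ℓ]) * ((rhoTwo ℓ σ : ℤ_[ℓ]) : ℚ_[ℓ]) := by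
  exact hasKummerProperties_and_polylogChar_eq γ ℓ hγ σ
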